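/- **Corollary 4 (Global flux Gauss–Lobatto DGSEM: superconvergence at steady state).** *Setting.* Let $p\ge 1$, $a<b$, and let $\Omega\subseteq\mathbb R^m$ be an open set of admissible states. Consider the balance law $\partial_tU+\partial_xF(U)=S(U;\varphi(x))$ on $[a,b]$ with $F$ smooth on $\Omega$ and $(U,x)\mapsto S(U;\varphi(x))$ smooth on $\Omega\times[a,b]$. A smooth exact steady solution is a smooth $U^e:[a,b]\to\Omega$ with $\frac{d}{dx}F(U^e(x))=S(U^e(x);\varphi(x))$. *Scheme.* Let $0=\xi_0<\dots<\xi_p=1$ be the Gauss–Lobatto points of $[0,1]$ (the zeros of $\frac{d^{p-1}}{dx^{p-1}}\big(x^p(x-1)^p\big)$), with Lagrange basis $\phi_0,\dots,\phi_p$ and quadrature weights $w_i=\int_0^1\phi_i$; put $D_{ij}=\phi_j'(\xi_i)$, $\mathcal I_{jk}=\int_0^{\xi_j}\phi_k\,d\xi$, $\mathcal M=\mathrm{diag}(w_i)$, $\mathcal B=\mathrm{diag}(-1,0,\dots,0,1)$. Split $[a,b]$ into consecutive elements $K=[x_K^-,x_K^+]$ of width $h_K\le h$, with nodes $x_{K,i}=x_K^-+h_K\xi_i$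 and unknowns $U_{K,i}\in\Omega$. The steady equations of the DGSEM with global flux quadrature of the source are, in every element, $$D\,\mathbf F+\mathcal M^{-1}\mathcal B(\widehat{\mathbf F}-\mathbf F)=h_K\,D\,\mathcal I\,\mathbf S ,$$ where $\mathbf F_i=F(U_{K,i})$, $\mathbf S_k=S(U_{K,k};\varphi(x_{K,k}))$ and the numerical flux at an interface with left and right states $U^-,U^+$ is $\widehat F=\alpha F(U^+)+(1-\alpha)F(U^-)+\mathcal D(U^+-U^-)$, with matrices $\alpha,\mathcal D$ that may depend on $(U^-,U^+)$ (at $a$ and $b$ the exterior state is the interior trace). A *discrete steady state* with initial flux $F_0$ is a solution $U^*=(U^*_{K,i})$ of these equations with values in $\Omega$ that is nodally continuous (the values of neighbouring elements at their common endpoint agree) and satisfies $F(U^*)=F_0$ at $x=a$. *Hypotheses.* $F$ is injective on $\Omega$ and its inverse $F(\Omega)\to\Omega$ is bounded (maps bounded sets to bounded sets). There is a matrix $A(U,V)$ with $$F(U)-F(V)=A(U,V)(U-V)\qquad(U,V\in\Omega),$$ whose entries are bounded uniformly in $U,V\in\Omega$, and which is diagonalizable with eigenvalues satisfying $\min_j|\lambda_j(A(U,V))|\ge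 C_A>0$ for all $U,V\in\Omega$. *Conclusion.* Let $U^e$ be any smooth exact steady solution and $F_0=F(U^e(a))$. 1. There are a compact $Q\subseteq\Omega$ and $h_0>0$ such that on every mesh with $h\le h_0$ a discrete steady state $U^*$ with initial flux $F_0$ and values in $Q$ exists. 2. For every $B\subseteq\Omega$ such that $S(U;\varphi(x))$ is bounded for $U\in B$, $x\in[a,b]$ (for example $B=\Omega$ if the source is bounded, or any compact $B\subseteq\Omega$) there are $C,h_0>0$, independent of the mesh, such that on every mesh with $h\le h_0$ there is at most one discrete steady state $U^*$ with initial flux $F_0$ and values in $B$, and it satisfies, for every element $K$ and every $i$, $$\|U^*_{K,0}-U^e(x_K^-)\|\le C h^{2p},\quad \|U^*_{K,p}-U^e(x_K^+)\|\le C h^{2p},\quad \|U^*_{K,i}-U^e(x_{K,i})\|\le C h^{\min(p+2,2p)} .$$ -/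

import Mathlib

open Set Polynomial
open scoped ContDiff

noncomputable section

/-! ### Gauss-Lobatto reference element `[0,1]` -/

/-- The `p + 1` Gauss-Lobatto points of `[0,1]`, in increasing order: the zeros of
`d^(p-1)/dx^(p-1) (x^p (x-1)^p)`, a polynomial of degree `p + 1`
(it is a multiple of `x (x-1) P_p'(x)` with `P_p` the shifted Legendre polynomial). -/
def IsGaussLobatto (p : ℕ) (ξ : Fin (p + 1) → ℝ) : Prop :=
  StrictMono ξ ∧
    ∀ i, (derivative^[p - 1] ((X : ℝ[X]) ^ p * (X - 1) ^ p)).eval (ξ i) = 0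

/-- The Lagrange basis polynomial attached to the `i`-th node. -/
def lagrangeBasis {p : ℕ} (ξ : Fin (p + 1) → ℝ) (i : Fin (p + 1)) : ℝ[X] :=
  Lagrange.basis Finset.univ ξ i

/-- The quadrature weights, i.e. the diagonal of the mass matrix. -/
def quadWeight {p : ℕ} (ξ : Fin (p + 1) → ℝ) (i : Fin (p + 1)) : ℝ :=
  ∫ t in (0 : ℝ)..1, (lagrangeBasis ξ i).eval t

/-- The differentiation matrix: derivative of the `j`-th basis function at the `i`-th node. -/
def diffMatrix {p : ℕ} (ξ : Fin (p + 1) → ℝ) : Matrix (Fin (p + 1)) (Fin (p + 1)) ℝ :=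
  fun i j => (derivative (lagrangeBasis ξ j)).eval (ξ i)

/-- The integration matrix: integral of the `k`-th basis function from `0` to the `j`-th node. -/
def intMatrix {p : ℕ} (ξ : Fin (p + 1) → ℝ) : Matrix (Fin (p + 1)) (Fin (p + 1)) ℝ :=
  fun j k => ∫ t in (0 : ℝ)..(ξ j), (lagrangeBasis ξ k).eval t

/-! ### Meshes -/

/-- A tessellation of `[a,b]` into `N` consecutive elements. -/
structure Mesh (a b : ℝ) where
  N : ℕ
  vertex : Fin (N + 1) → ℝ
  strictMono : StrictMono vertex
  left_eq : vertex 0 = a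
  right_eq : vertex (Fin.last N) = b

/-- The width of the element `K`. -/
def Mesh.width {a b : ℝ} (T : Mesh a b) (K : Fin T.N) : ℝ :=
  T.vertex K.succ - T.vertex K.castSucc

/-- The `i`-th collocation point of the element `K`. -/
def Mesh.node {a b : ℝ} (T : Mesh a b) {p : ℕ} (ξ : Fin (p + 1) → ℝ)
    (K : Fin T.N) (i : Fin (p + 1)) : ℝ :=
  T.vertex K.castSucc + T.width K * ξ i

/-! ### The DGSEM with global flux quadrature of the source

States are vectors of `Fin m → ℝ`, and `U K i` is the value at the `i`-th node of the element `K`.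
-/

/-- The numerical flux `α F⁺ + (1 - α) F⁻ + 𝒟 (U⁺ - U⁻)` for a left state `uM` and a right
state `uP`; the matrices `α` and `𝒟` may depend on the two states. -/
def numFlux {m : ℕ} (F : (Fin m → ℝ) → (Fin m → ℝ))
    (α 𝒟 : (Fin m → ℝ) → (Fin m → ℝ) → Matrix (Fin m) (Fin m) ℝ)
    (uM uP : Fin m → ℝ) : Fin m → ℝ :=
  (α uM uP).mulVec (F uP) + (1 - α uM uP).mulVec (F uM) + (𝒟 uM uP).mulVec (uP - uM)

/-- The state on the other side of the left end of `K`. At the left end of the domain the exterior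
state is the interior trace: the boundary data agree with the steady state. -/
def leftNeighbour {m p N : ℕ} (U : Fin N → Fin (p + 1) → (Fin m → ℝ)) (K : Fin N) : Fin m → ℝ :=
  if 0 < K.val then U ⟨K.val - 1, by omega⟩ (Fin.last p) else U K 0

/-- The state on the other side of the right end of `K`, with the same convention at the right end
of the domain. -/
def rightNeighbour {m p N : ℕ} (U : Fin N → Fin (p + 1) → (Fin m → ℝ)) (K : Fin N) : Fin m → ℝ :=
  if hK : K.val + 1 < N then U ⟨K.val + 1, hK⟩ 0 else U K (Fin.last p)

/-- The spatial residual of the scheme at the `i`-th node of the element `K` (strong form):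
`D F + M⁻¹ B (F̂ - F) - h D I S`, where `M` is the diagonal matrix of quadrature weights and
`B = diag(-1, 0, …, 0, 1)`. The semi-discrete scheme says that the time derivative of the nodal
values is minus this residual, up to the factor `h` of the reference map. -/
def dgResidual {a b : ℝ} {m p : ℕ} {D : Type*} (F : (Fin m → ℝ) → (Fin m → ℝ))
    (S : (Fin m → ℝ) → D → (Fin m → ℝ)) (φ : ℝ → D)
    (α 𝒟 : (Fin m → ℝ) → (Fin m → ℝ) → Matrix (Fin m) (Fin m) ℝ)
    (ξ : Fin (p + 1) → ℝ) (T : Mesh a b)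
    (U : Fin T.N → Fin (p + 1) → (Fin m → ℝ)) (K : Fin T.N) (i : Fin (p + 1)) : Fin m → ℝ :=
  (∑ j, diffMatrix ξ i j • F (U K j))
    + (quadWeight ξ i)⁻¹ •
        ((if i = Fin.last p then
            numFlux F α 𝒟 (U K (Fin.last p)) (rightNeighbour U K) - F (U K (Fin.last p)) else 0)
          - (if i = 0 then numFlux F α 𝒟 (leftNeighbour U K) (U K 0) - F (U K 0) else 0))
    - T.width K • ∑ k, (diffMatrix ξ * intMatrix ξ) i k • S (U K k) (φ (T.node ξ K k))

/-- `U` is a nodally continuous discrete steady state of the scheme, with admissible nodal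
values and with flux `F₀` at the left end of the domain. -/
structure IsDiscreteSteadyState {a b : ℝ} {m p : ℕ} {D : Type*} (Ω : Set (Fin m → ℝ))
    (F : (Fin m → ℝ) → (Fin m → ℝ)) (S : (Fin m → ℝ) → D → (Fin m → ℝ)) (φ : ℝ → D)
    (α 𝒟 : (Fin m → ℝ) → (Fin m → ℝ) → Matrix (Fin m) (Fin m) ℝ)
    (ξ : Fin (p + 1) → ℝ) (F₀ : Fin m → ℝ) (T : Mesh a b)
    (U : Fin T.N → Fin (p + 1) → (Fin m → ℝ)) : Prop where
  admissible : ∀ K i, U K i ∈ Ω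
  steady : ∀ K i, dgResidual F S φ α 𝒟 ξ T U K i = 0
  nodally_continuous : ∀ K L : Fin T.N, L.val = K.val + 1 → U L 0 = U K (Fin.last p)
  initial : ∀ K : Fin T.N, K.val = 0 → F (U K 0) = F₀

/-! ### The continuous problem -/

/-- `Ue` is a smooth exact steady solution on `[a,b]`: `d/dx F(Ue) = S(Ue; φ)`. -/
structure IsSmoothSteadySolution {m : ℕ} {D : Type*} (a b : ℝ) (Ω : Set (Fin m → ℝ))
    (F : (Fin m → ℝ) → (Fin m → ℝ)) (S : (Fin m → ℝ) → D → (Fin m → ℝ)) (φ : ℝ → D)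
    (Ue : ℝ → (Fin m → ℝ)) : Prop where
  admissible : ∀ x ∈ Icc a b, Ue x ∈ Ω
  smooth : ContDiffOn ℝ ∞ Ue (Icc a b)
  ode : ∀ x ∈ Icc a b,
    HasDerivWithinAt (fun y => F (Ue y)) (S (Ue x) (φ x)) (Icc a b) x

/-- `F` is invertible on the admissible set, with a uniquely defined inverse that is bounded
(it maps bounded sets of fluxes to bounded sets of states). -/
def HasBoundedInverse {m : ℕ} (Ω : Set (Fin m → ℝ)) (F : (Fin m → ℝ) → (Fin m → ℝ)) : Prop :=
  InjOn F Ω ∧ ∀ B : Set (Fin m → ℝ), Bornology.IsBounded B → Bornology.IsBounded (Ω ∩ F ⁻¹' B)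

/-- The real matrix `M` is diagonalizable (real or complex eigenvalues being allowed) and all its
eigenvalues have modulus at least `c`. -/
def IsDiagonalizableAwayFromZero {m : ℕ} (c : ℝ) (M : Matrix (Fin m) (Fin m) ℝ) : Prop :=
  ∃ (P : Matrix (Fin m) (Fin m) ℂ) (ev : Fin m → ℂ), IsUnit P.det ∧
    M.map (fun r : ℝ => (r : ℂ)) * P = P * Matrix.diagonal ev ∧ ∀ j, c ≤ ‖ev j‖

/-- `A` is a flux linearization `F(U) - F(V) = A(U,V) (U - V)` on the admissible set, with
uniformly bounded entries, diagonalizable with eigenvalue moduli bounded below by `c`. -/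
structure IsFluxLinearization {m : ℕ} (Ω : Set (Fin m → ℝ)) (F : (Fin m → ℝ) → (Fin m → ℝ))
    (A : (Fin m → ℝ) → (Fin m → ℝ) → Matrix (Fin m) (Fin m) ℝ) (c : ℝ) : Prop where
  linearization : ∀ u ∈ Ω, ∀ v ∈ Ω, F u - F v = (A u v).mulVec (u - v)
  bounded : ∃ M : ℝ, ∀ u ∈ Ω, ∀ v ∈ Ω, ∀ i j, |A u v i j| ≤ M
  eigenvalues : ∀ u ∈ Ω, ∀ v ∈ Ω, IsDiagonalizableAwayFromZero c (A u v)

end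

/-! ### Polynomials and integrals -/

/-! Nodal continuity makes the two states at every interface equal, so the numerical flux reduces to
F whatever α and 𝒟 are, and the scheme on an element reads D (F - h I S) = 0. Differentiation of
polynomials of degree at most p annihilates only constants, hence F_i = F_0 + h ∑ I_ik S_k. In the
variable y = F(U) this is the Lobatto IIIA collocation method for y' = S(F⁻¹(y); φ(x)); see
`forall_dgResidual_eq_zero_iff` and `isDiscreteSteadyState_iff`.

The change of variable is harmless because A(U,V) has a uniformly bounded inverse: its determinant
is bounded below by the eigenvalues and its adjugate above by the entries. So F⁻¹ is Lipschitz, F(Ω)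
is open and F⁻¹ is smooth. A compact tube around the exact flux lies in F(Ω), and there the
right-hand side has uniform constants (`exists_isSmoothTube`).

By exactness of the quadratures the exact solution leaves stage defects O(h^(p+2)), an endpoint
defect O(h^(2p+1)), and defect moments O(h^(2p-q)) (`exists_stageDefect_le`). The order 2p needs
more than stage bounds: one follows the moments Q_q = ∑ w_i ξ_i^q e_i of the stage errors.
Linearizing the source and Taylor-expanding its Jacobian expresses the moments of the source error
through the h^k Q_(q+k), up to O(‖e_0‖ + h^(2p)). Conversely, the stage equations and the condition
D(p - 1) express Q_q through h times moments of the source error. Every round trip gains a power of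
h (`exists_moment_bound`), so an element takes ‖e_0‖ to at most (1 + Ch)‖e_0‖ + C h^(2p+1)
(`IsStageError.exists_le`).

A discrete Gronwall argument gives h^(2p) at the vertices; inside an element the stage error h^(p+2)
is added. Existence on an element is a contraction argument. For uniqueness, a bounded source first
forces all stages into the tube, where the Lipschitz bound applies. -/

theorem integral_eval_derivative (f : ℝ[X]) (a b : ℝ) :
    ∫ t in a..b, (derivative f).eval t = f.eval b - f.eval a :=
  intervalIntegral.integral_eq_sub_of_hasDerivAt (fun x _ => f.hasDerivAt x)
    ((derivative f).continuous.intervalIntegrable _ _)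

theorem exists_antiderivative (f : ℝ[X]) :
    ∃ g : ℝ[X], derivative g = f ∧ g.natDegree ≤ f.natDegree + 1 := by
  refine ⟨∑ k ∈ Finset.range (f.natDegree + 1), C (f.coeff k / (k + 1)) * X ^ (k + 1), ?_, ?_⟩
  · conv_rhs => rw [f.as_sum_range_C_mul_X_pow]
    rw [derivative_sum]
    refine Finset.sum_congr rfl fun k _ => ?_
    rw [derivative_C_mul_X_pow]
    have : (k : ℝ) + 1 ≠ 0 := by positivity
    congr 2
    push_cast
    field_simp
  · refine natDegree_sum_le_of_forall_le _ _ fun k hk => ?_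
    refine (natDegree_C_mul_X_pow_le _ _).trans ?_
    have := Finset.mem_range.1 hk
    omega

theorem integral_eval_add (f g : ℝ[X]) (a b : ℝ) :
    ∫ t in a..b, (f + g).eval t = (∫ t in a..b, f.eval t) + ∫ t in a..b, g.eval t := by
  simp only [eval_add]
  exact intervalIntegral.integral_add (f.continuous.intervalIntegrable _ _)
    (g.continuous.intervalIntegrable _ _)

theorem integral_eval_mul_derivative (f g : ℝ[X]) (a b : ℝ) :
    ∫ t in a..b, (f * derivative g).eval t =
      (f * g).eval b - (f * g).eval a - ∫ t in a..b, (derivative f * g).eval t := by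
  have := integral_eval_derivative (f * g) a b
  rw [derivative_mul, integral_eval_add] at this
  linarith

/-- Repeated integration by parts against a polynomial that vanishes to order `p` at `0`, `1`. -/
theorem integral_mul_iterate_derivative_eq_zero {p : ℕ} {W : ℝ[X]} (h0 : X ^ p ∣ W)
    (h1 : (X - 1) ^ p ∣ W) :
    ∀ k : ℕ, k ≤ p → ∀ q : ℝ[X], q.degree < k →
      ∫ t in (0 : ℝ)..1, (q * derivative^[k] W).eval t = 0 := by
  intro k
  induction k with
  | zero =>
    intro _ q hq
    have : q = 0 := by simpa using hq
    simp [this]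
  | succ k ih =>
    intro hk q hq
    have e0 : (derivative^[k] W).eval 0 = 0 := by
      obtain ⟨r, hr⟩ := pow_sub_dvd_iterate_derivative_of_pow_dvd k h0
      rw [hr, eval_mul, eval_pow, eval_X, zero_pow (by omega), zero_mul]
    have e1 : (derivative^[k] W).eval 1 = 0 := by
      obtain ⟨r, hr⟩ := pow_sub_dvd_iterate_derivative_of_pow_dvd k h1
      rw [hr, eval_mul, eval_pow, eval_sub, eval_X, eval_one, sub_self,
        zero_pow (by omega), zero_mul]
    rw [Function.iterate_succ_apply', integral_eval_mul_derivative, ih (by omega)]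
    · simp [e0, e1]
    · by_cases hq0 : q = 0
      · simp [hq0]
      · have := degree_derivative_lt hq0
        rw [degree_eq_natDegree hq0] at this hq
        have hq' : q.natDegree < k + 1 := by exact_mod_cast hq
        exact this.trans_le (by exact_mod_cast Nat.lt_succ_iff.1 hq')

/-! ### The Gauss-Lobatto points -/

/-- The polynomial whose zeros are the Gauss-Lobatto points. -/
noncomputable def lobattoPoly (p : ℕ) : ℝ[X] := derivative^[p - 1] ((X : ℝ[X]) ^ p * (X - 1) ^ p)

/-- Leibniz' rule: p - 1 derivatives exhaust neither p-th power, so each term keeps both factors x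
and x - 1, with a positive coefficient. The endpoints are therefore zeros, and outside [0,1] all
terms have the same sign. -/
theorem lobattoPoly_eval {p : ℕ} (hp : 1 ≤ p) :
    ∃ c : ℕ → ℝ, (∀ k < p, 0 < c k) ∧
      ∀ x, (lobattoPoly p).eval x = ∑ k ∈ Finset.range p, c k * (x ^ (k + 1) * (x - 1) ^ (p - k)) := by
  refine ⟨fun k => ((p - 1).choose k * (p.descFactorial (p - 1 - k) * p.descFactorial k) : ℕ),
    fun k hk => ?_, fun x => ?_⟩
  · have h1 := Nat.choose_pos (show k ≤ p - 1 by omega)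
    have h2 : 0 < p.descFactorial (p - 1 - k) := Nat.pos_of_ne_zero (by
      rw [Ne, Nat.descFactorial_eq_zero_iff_lt]; omega)
    have h3 : 0 < p.descFactorial k := Nat.pos_of_ne_zero (by
      rw [Ne, Nat.descFactorial_eq_zero_iff_lt]; omega)
    exact Nat.cast_pos.2 (Nat.mul_pos h1 (Nat.mul_pos h2 h3))
  · have hp' : (p - 1).succ = p := by omega
    rw [lobattoPoly, iterate_derivative_mul, eval_finsetSum, hp']
    refine Finset.sum_congr rfl fun k hk => ?_
    have hk := Finset.mem_range.1 hk
    have h1 : ((X : ℝ[X]) - 1) = X - C 1 := by simp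
    rw [h1, iterate_derivative_X_sub_pow, iterate_derivative_X_pow_eq_smul]
    have h2 : p - (p - 1 - k) = k + 1 := by omega
    simp [h2]
    ring

theorem lobattoPoly_eval_pos {p : ℕ} (hp : 1 ≤ p) {x : ℝ} (hx : 1 < x) :
    0 < (lobattoPoly p).eval x := by
  obtain ⟨c, hc, h⟩ := lobattoPoly_eval hp
  rw [h]
  refine Finset.sum_pos (fun k hk => ?_) ⟨0, Finset.mem_range.2 hp⟩
  have := hc k (Finset.mem_range.1 hk)
  have : 0 < x - 1 := by linarith
  positivity

theorem lobattoPoly_eval_ne_zero_of_neg {p : ℕ} (hp : 1 ≤ p) {x : ℝ} (hx : x < 0) :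
    (lobattoPoly p).eval x ≠ 0 := by
  obtain ⟨c, hc, h⟩ := lobattoPoly_eval hp
  rw [h]
  -- For negative x both factors are negative and their exponents always add up to p + 1, so every
  -- term has the sign (-1)^(p+1).
  have : ∑ k ∈ Finset.range p, c k * (x ^ (k + 1) * (x - 1) ^ (p - k)) =
      (-1) ^ (p + 1) * ∑ k ∈ Finset.range p, c k * ((-x) ^ (k + 1) * (1 - x) ^ (p - k)) := by
    rw [Finset.mul_sum]
    refine Finset.sum_congr rfl fun k hk => ?_
    have hk := Finset.mem_range.1 hk
    have e : p + 1 = (k + 1) + (p - k) := by omega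
    rw [e, pow_add (-1 : ℝ) (k + 1)]
    have e1 : x ^ (k + 1) = (-1) ^ (k + 1) * (-x) ^ (k + 1) := by rw [← mul_pow]; ring
    have e2 : (x - 1) ^ (p - k) = (-1) ^ (p - k) * (1 - x) ^ (p - k) := by rw [← mul_pow]; ring
    rw [e1, e2]
    ring
  rw [this]
  refine mul_ne_zero (by simp) (ne_of_gt ?_)
  refine Finset.sum_pos (fun k hk => ?_) ⟨0, Finset.mem_range.2 hp⟩
  have := hc k (Finset.mem_range.1 hk)
  have : 0 < 1 - x := by linarith
  have : 0 < -x := by linarith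
  positivity

theorem lobattoPoly_eval_zero {p : ℕ} (hp : 1 ≤ p) : (lobattoPoly p).eval 0 = 0 := by
  obtain ⟨c, hc, h⟩ := lobattoPoly_eval hp
  simp [h]

theorem lobattoPoly_eval_one {p : ℕ} (hp : 1 ≤ p) : (lobattoPoly p).eval 1 = 0 := by
  obtain ⟨c, hc, h⟩ := lobattoPoly_eval hp
  rw [h]
  refine Finset.sum_eq_zero fun k hk => ?_
  have := Finset.mem_range.1 hk
  simp [show p - k ≠ 0 by omega]

theorem lobattoPoly_ne_zero {p : ℕ} (hp : 1 ≤ p) : lobattoPoly p ≠ 0 := by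
  intro h
  have := lobattoPoly_eval_pos hp one_lt_two
  simp [h] at this

theorem natDegree_lobattoPoly_le (p : ℕ) (hp : 1 ≤ p) : (lobattoPoly p).natDegree ≤ p + 1 := by
  refine (natDegree_iterate_derivative _ _).trans ?_
  have h1 : ((X : ℝ[X]) - 1).natDegree ≤ 1 := by
    have : (X : ℝ[X]) - 1 = X - C 1 := by simp
    rw [this, natDegree_X_sub_C]
  have : ((X : ℝ[X]) ^ p * (X - 1) ^ p).natDegree ≤ p + p * 1 :=
    natDegree_mul_le_of_le (natDegree_X_pow_le p) (natDegree_pow_le_of_le p h1)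
  omega

namespace IsGaussLobatto

variable {p : ℕ} {ξ : Fin (p + 1) → ℝ}

theorem eval_lobattoPoly (hξ : IsGaussLobatto p ξ) (i : Fin (p + 1)) :
    (lobattoPoly p).eval (ξ i) = 0 := hξ.2 i

/-- The p + 1 distinct nodes are zeros of a nonzero polynomial, which bounds the degree from below
without computing the leading coefficient. -/
theorem natDegree_lobattoPoly (hξ : IsGaussLobatto p ξ) (hp : 1 ≤ p) :
    (lobattoPoly p).natDegree = p + 1 := by
  refine le_antisymm (natDegree_lobattoPoly_le p hp) ?_
  by_contra h
  exact lobattoPoly_ne_zero hp (eq_zero_of_natDegree_lt_card_of_eval_eq_zero _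
    hξ.1.injective hξ.2 (by simpa using h))

theorem nonneg (hξ : IsGaussLobatto p ξ) (hp : 1 ≤ p) (i : Fin (p + 1)) : 0 ≤ ξ i := by
  by_contra h
  exact lobattoPoly_eval_ne_zero_of_neg hp (not_le.1 h) (hξ.2 i)

theorem le_one (hξ : IsGaussLobatto p ξ) (hp : 1 ≤ p) (i : Fin (p + 1)) : ξ i ≤ 1 := by
  by_contra h
  exact (lobattoPoly_eval_pos hp (not_le.1 h)).ne' (hξ.2 i)

/-- A zero that is not a node would be the (p + 2)-nd zero of a polynomial of degree p + 1. Since 0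
and 1 are zeros, this makes them the extreme nodes. -/
theorem exists_eq_of_eval_eq_zero (hξ : IsGaussLobatto p ξ) (hp : 1 ≤ p) {x : ℝ}
    (hx : (lobattoPoly p).eval x = 0) : ∃ i, ξ i = x := by
  by_contra! h
  refine lobattoPoly_ne_zero hp (eq_zero_of_natDegree_lt_card_of_eval_eq_zero _
    (f := (Fin.cons x ξ : Fin (p + 2) → ℝ)) ?_ ?_ ?_)
  · rw [Fin.cons_injective_iff]
    exact ⟨fun ⟨i, hi⟩ => h i hi, hξ.1.injective⟩
  · intro i
    refine Fin.cases ?_ (fun j => ?_) i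
    · simpa using hx
    · simpa using hξ.eval_lobattoPoly j
  · rw [hξ.natDegree_lobattoPoly hp, Fintype.card_fin]
    omega

theorem first (hξ : IsGaussLobatto p ξ) (hp : 1 ≤ p) : ξ 0 = 0 := by
  obtain ⟨i, hi⟩ := hξ.exists_eq_of_eval_eq_zero hp (lobattoPoly_eval_zero hp)
  exact le_antisymm (hi ▸ hξ.1.monotone (Fin.zero_le i)) (hξ.nonneg hp 0)

theorem last (hξ : IsGaussLobatto p ξ) (hp : 1 ≤ p) : ξ (Fin.last p) = 1 := by
  obtain ⟨i, hi⟩ := hξ.exists_eq_of_eval_eq_zero hp (lobattoPoly_eval_one hp)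
  exact le_antisymm (hξ.le_one hp _) (hi ▸ hξ.1.monotone (Fin.le_last i))

end IsGaussLobatto

/-! ### Interpolatory quadrature -/

section Interpolation

variable {p : ℕ} {ξ : Fin (p + 1) → ℝ}

theorem natDegree_lagrangeBasis (hξ : Function.Injective ξ) (i : Fin (p + 1)) :
    (lagrangeBasis ξ i).natDegree = p := by
  have := Lagrange.degree_basis (s := Finset.univ) (v := ξ) (i := i) hξ.injOn (Finset.mem_univ i)
  exact natDegree_eq_of_degree_eq_some (by simpa [lagrangeBasis] using this)

theorem eval_lagrangeBasis (hξ : Function.Injective ξ) (i j : Fin (p + 1)) :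
    (lagrangeBasis ξ i).eval (ξ j) = if i = j then 1 else 0 := by
  split_ifs with h
  · subst h
    exact Lagrange.eval_basis_self hξ.injOn (Finset.mem_univ i)
  · exact Lagrange.eval_basis_of_ne h (Finset.mem_univ j)

theorem eq_sum_lagrangeBasis (hξ : Function.Injective ξ) {f : ℝ[X]} (hf : f.natDegree ≤ p) :
    f = ∑ i, C (f.eval (ξ i)) * lagrangeBasis ξ i := by
  have := Lagrange.eq_interpolate (s := Finset.univ) (v := ξ) (f := f) hξ.injOn
    (by
      rw [Finset.card_univ, Fintype.card_fin]
      exact degree_le_natDegree.trans_lt (by exact_mod_cast Nat.lt_succ_iff.2 hf))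
  rwa [Lagrange.interpolate_apply] at this

theorem integral_eq_sum_lagrangeBasis (hξ : Function.Injective ξ) {f : ℝ[X]}
    (hf : f.natDegree ≤ p) (a b : ℝ) :
    ∫ t in a..b, f.eval t =
      ∑ i, f.eval (ξ i) * ∫ t in a..b, (lagrangeBasis ξ i).eval t := by
  conv_lhs => rw [eq_sum_lagrangeBasis hξ hf]
  simp only [eval_finsetSum, eval_mul, eval_C]
  rw [intervalIntegral.integral_finsetSum]
  · simp
  · intro i _
    exact ((lagrangeBasis ξ i).continuous.intervalIntegrable _ _).const_mul _

theorem sum_intMatrix_mul_eval (hξ : Function.Injective ξ) {f : ℝ[X]} (hf : f.natDegree ≤ p)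
    (j : Fin (p + 1)) :
    ∑ k, intMatrix ξ j k * f.eval (ξ k) = ∫ t in (0 : ℝ)..(ξ j), f.eval t := by
  rw [integral_eq_sum_lagrangeBasis hξ hf]
  exact Finset.sum_congr rfl fun k _ => mul_comm _ _

theorem integral_pow_eval (d : ℕ) (x : ℝ) :
    ∫ t in (0 : ℝ)..x, ((X : ℝ[X]) ^ d).eval t = x ^ (d + 1) / (d + 1) := by
  simp

theorem sum_intMatrix_mul_pow (hξ : Function.Injective ξ) {d : ℕ} (hd : d ≤ p)
    (j : Fin (p + 1)) :
    ∑ k, intMatrix ξ j k * ξ k ^ d = ξ j ^ (d + 1) / (d + 1) := by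
  have := sum_intMatrix_mul_eval hξ (f := X ^ d) ((natDegree_X_pow_le d).trans hd) j
  rw [integral_pow_eval] at this
  simpa using this

/-- The differentiation matrix is exact on polynomials of degree at most `p`. -/
theorem sum_diffMatrix_mul_eval (hξ : Function.Injective ξ) {f : ℝ[X]} (hf : f.natDegree ≤ p)
    (i : Fin (p + 1)) :
    ∑ j, diffMatrix ξ i j * f.eval (ξ j) = (derivative f).eval (ξ i) := by
  conv_rhs => rw [eq_sum_lagrangeBasis hξ hf]
  simp [eval_finsetSum, diffMatrix, mul_comm]

theorem sum_diffMatrix (hξ : Function.Injective ξ) (i : Fin (p + 1)) :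
    ∑ j, diffMatrix ξ i j = 0 := by
  simpa using sum_diffMatrix_mul_eval hξ (f := 1) (by simp) i

/-- The kernel of the differentiation matrix consists of the constants. -/
theorem eq_of_sum_diffMatrix_mul_eq_zero (hξ : Function.Injective ξ)
    {v : Fin (p + 1) → ℝ}
    (hv : ∀ i, ∑ j, diffMatrix ξ i j * v j = 0) (i : Fin (p + 1)) : v i = v 0 := by
  set f : ℝ[X] := ∑ j, C (v j) * lagrangeBasis ξ j with hf
  have hdeg : f.natDegree ≤ p := natDegree_sum_le_of_forall_le _ _ fun j _ =>
    (natDegree_C_mul_le _ _).trans (natDegree_lagrangeBasis hξ j).le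
  have heval : ∀ j, f.eval (ξ j) = v j := by
    intro j
    simp [hf, eval_finsetSum, eval_lagrangeBasis hξ]
  have hd : derivative f = 0 := by
    refine eq_zero_of_natDegree_lt_card_of_eval_eq_zero _ hξ (fun i => ?_) ?_
    · rw [← sum_diffMatrix_mul_eval hξ hdeg, ← hv i]
      simp [heval]
    · rw [Fintype.card_fin]
      exact (natDegree_derivative_le f).trans_lt (by omega)
  have := derivative_eq_zero.1 hd
  rw [← heval i, ← heval 0, eq_C_of_natDegree_eq_zero this, eval_C, eval_C]

end Interpolation

namespace IsGaussLobatto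

variable {p : ℕ} {ξ : Fin (p + 1) → ℝ}

theorem intMatrix_last (hξ : IsGaussLobatto p ξ) (hp : 1 ≤ p) (k : Fin (p + 1)) :
    intMatrix ξ (Fin.last p) k = quadWeight ξ k := by
  rw [intMatrix, quadWeight, hξ.last hp]

theorem intMatrix_zero (hξ : IsGaussLobatto p ξ) (hp : 1 ≤ p) (k : Fin (p + 1)) :
    intMatrix ξ 0 k = 0 := by
  rw [intMatrix, hξ.first hp, intervalIntegral.integral_same]

/-- Gauss-Lobatto quadrature is exact on polynomials of degree less than `2 p`. -/
theorem sum_quadWeight_mul_eval (hξ : IsGaussLobatto p ξ) (hp : 1 ≤ p) {f : ℝ[X]}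
    (hf : f.natDegree < 2 * p) :
    ∑ i, quadWeight ξ i * f.eval (ξ i) = ∫ t in (0 : ℝ)..1, f.eval t := by
  set L := lobattoPoly p with hL
  have hL0 : L ≠ 0 := lobattoPoly_ne_zero hp
  have hLd : L.natDegree = p + 1 := hξ.natDegree_lobattoPoly hp
  have hdiv : L * (f / L) + f % L = f := EuclideanDomain.div_add_mod f L
  have hr : (f % L).natDegree ≤ p := by
    have := natDegree_mod_lt f (q := L) (by omega)
    omega
  -- The quotient has degree at most p - 2, so it is orthogonal to the (p - 1)-st derivative L; the
  -- remainder has degree at most p and is integrated exactly by interpolation.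
  have hq : (f / L).degree < ((p - 1 : ℕ) : WithBot ℕ) := by
    by_cases h0 : f / L = 0
    · rw [h0, degree_zero]
      exact WithBot.bot_lt_coe _
    · rw [← natDegree_lt_iff_degree_lt h0]
      have h1 : (L * (f / L)).natDegree = p + 1 + (f / L).natDegree := by
        rw [natDegree_mul hL0 h0, hLd]
      have h2 : L * (f / L) = f - f % L := by exact eq_sub_of_add_eq hdiv
      have h3 := natDegree_sub_le f (f % L)
      rw [← h2, h1] at h3
      have : max f.natDegree (f % L).natDegree < 2 * p := max_lt hf (by omega)
      omega
  have hz : ∫ t in (0 : ℝ)..1, (L * (f / L)).eval t = 0 := by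
    rw [mul_comm]
    exact integral_mul_iterate_derivative_eq_zero (p := p) (Dvd.intro _ rfl)
      (Dvd.intro_left _ rfl) (p - 1) (by omega) _ hq
  have he : ∀ i, f.eval (ξ i) = (f % L).eval (ξ i) := by
    intro i
    conv_lhs => rw [← hdiv]
    rw [eval_add, eval_mul, hξ.eval_lobattoPoly, zero_mul, zero_add]
  have hi : ∫ t in (0 : ℝ)..1, f.eval t = ∫ t in (0 : ℝ)..1, (f % L).eval t := by
    conv_lhs => rw [← hdiv]
    rw [integral_eval_add, hz, zero_add]
  rw [hi, integral_eq_sum_lagrangeBasis hξ.1.injective hr]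
  exact Finset.sum_congr rfl fun i _ => by rw [he, quadWeight, mul_comm]

theorem sum_quadWeight_mul_pow (hξ : IsGaussLobatto p ξ) (hp : 1 ≤ p) {d : ℕ} (hd : d < 2 * p) :
    ∑ i, quadWeight ξ i * ξ i ^ d = 1 / (d + 1) := by
  have := hξ.sum_quadWeight_mul_eval hp (f := X ^ d) (by simpa using hd)
  rw [integral_pow_eval] at this
  simpa using this

/-- The simplifying assumption `D(p - 1)` of collocation methods. -/
theorem sum_quadWeight_mul_pow_mul_intMatrix (hξ : IsGaussLobatto p ξ) (hp : 1 ≤ p) {q : ℕ}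
    (hq : q + 2 ≤ p) (j : Fin (p + 1)) :
    ∑ i, quadWeight ξ i * ξ i ^ q * intMatrix ξ i j =
      quadWeight ξ j * (1 - ξ j ^ (q + 1)) / (q + 1) := by
  obtain ⟨Φ, hΦ, hΦd⟩ := exists_antiderivative (lagrangeBasis ξ j)
  rw [natDegree_lagrangeBasis hξ.1.injective] at hΦd
  have hI : ∀ i, intMatrix ξ i j = Φ.eval (ξ i) - Φ.eval 0 := by
    intro i
    rw [intMatrix, ← hΦ, integral_eval_derivative]
  -- With Ψ the antiderivative vanishing at 0, the claim is integration by parts of x^q Ψ, carried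
  -- over to the quadrature. Exactness for x^q Ψ, of degree at most q + p + 1, is what requires q +
  -- 2 ≤ p.
  set Ψ : ℝ[X] := Φ - C (Φ.eval 0) with hΨ
  have hΨd : derivative Ψ = lagrangeBasis ξ j := by simp [hΨ, hΦ]
  have hΨdeg : Ψ.natDegree ≤ p + 1 := (natDegree_sub_C (a := Φ.eval 0) (p := Φ)).le.trans hΦd
  have h1 : ∑ i, quadWeight ξ i * ξ i ^ q * intMatrix ξ i j =
      ∑ i, quadWeight ξ i * (X ^ q * Ψ).eval (ξ i) :=
    Finset.sum_congr rfl fun i _ => by rw [hI]; simp [hΨ, mul_assoc]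
  have hdeg1 : (X ^ q * Ψ).natDegree < 2 * p :=
    lt_of_le_of_lt (natDegree_mul_le_of_le (natDegree_X_pow_le q) hΨdeg) (by omega)
  have hdeg2 : (X ^ (q + 1) * lagrangeBasis ξ j).natDegree < 2 * p :=
    lt_of_le_of_lt (natDegree_mul_le_of_le (natDegree_X_pow_le (q + 1))
      (natDegree_lagrangeBasis hξ.1.injective j).le) (by omega)
  have h2 := integral_eval_mul_derivative (X ^ (q + 1)) Ψ 0 1
  rw [hΨd, ← hξ.sum_quadWeight_mul_eval hp hdeg2] at h2
  have h3 : ∫ t in (0 : ℝ)..1, (derivative (X ^ (q + 1)) * Ψ).eval t =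
      ((q : ℝ) + 1) * ∫ t in (0 : ℝ)..1, (X ^ q * Ψ).eval t := by
    rw [← intervalIntegral.integral_const_mul]
    congr 1
    ext t
    simp
    ring
  have h4 : ∑ i, quadWeight ξ i * (X ^ (q + 1) * lagrangeBasis ξ j).eval (ξ i) =
      quadWeight ξ j * ξ j ^ (q + 1) := by
    simp [eval_lagrangeBasis hξ.1.injective]
  have h5 : quadWeight ξ j = Ψ.eval 1 := by
    rw [quadWeight, ← hΨd, integral_eval_derivative]
    simp [hΨ]
  rw [h3, h4, ← hξ.sum_quadWeight_mul_eval hp hdeg1, ← h1] at h2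
  have h6 : (X ^ (q + 1) * Ψ).eval 1 - (X ^ (q + 1) * Ψ).eval 0 = quadWeight ξ j := by
    simp [h5]
  rw [h6] at h2
  have : (q : ℝ) + 1 ≠ 0 := by positivity
  field_simp
  linarith

end IsGaussLobatto

/-! ### Uniform Taylor expansions -/

section Taylor

variable {E : Type*} [NormedAddCommGroup E] [NormedSpace ℝ E] {a b : ℝ}

theorem uIcc_subset_Icc_of_mem {x y : ℝ} (hx : x ∈ Icc a b) (hy : y ∈ Icc a b) :
    uIcc x y ⊆ Icc a b :=
  (convex_Icc a b).ordConnected.uIcc_subset hx hy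

/-- Integrates a Taylor expansion of y' term by term: the mean value inequality on the segment from
x₀ to x supplies the extra factor |x - x₀|. -/
theorem norm_sub_sum_pow_smul_le {y y' : ℝ → E}
    (hy : ∀ x ∈ Icc a b, HasDerivWithinAt y (y' x) (Icc a b) x) {x₀ : ℝ} (hx₀ : x₀ ∈ Icc a b)
    {n : ℕ} {c : ℕ → E} {C : ℝ} (hC : 0 ≤ C)
    (h : ∀ x ∈ Icc a b, ‖y' x - ∑ k ∈ Finset.range n, (x - x₀) ^ k • c k‖ ≤ C * |x - x₀| ^ n)
    {x : ℝ} (hx : x ∈ Icc a b) :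
    ‖y x - y x₀ - ∑ k ∈ Finset.range n, ((x - x₀) ^ (k + 1) / (k + 1)) • c k‖ ≤
      C * |x - x₀| ^ (n + 1) := by
  have hsub := uIcc_subset_Icc_of_mem hx₀ hx
  set f : ℝ → E := fun t => y t - ∑ k ∈ Finset.range n, ((t - x₀) ^ (k + 1) / (k + 1)) • c k
    with hf
  have hder : ∀ t ∈ uIcc x₀ x, HasDerivWithinAt f
      (y' t - ∑ k ∈ Finset.range n, (t - x₀) ^ k • c k) (uIcc x₀ x) t := by
    intro t ht
    refine ((hy t (hsub ht)).mono hsub).sub ?_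
    refine HasDerivWithinAt.fun_sum fun k _ => ?_
    refine HasDerivWithinAt.smul_const ?_ _
    have h1 : HasDerivAt (fun t : ℝ => (t - x₀) ^ (k + 1) / ((k : ℝ) + 1))
        (((k + 1 : ℕ) * (t - x₀) ^ k * 1) / ((k : ℝ) + 1)) t :=
      (((hasDerivAt_id t).sub_const x₀).fun_pow (k + 1)).div_const _
    have : (k : ℝ) + 1 ≠ 0 := by positivity
    rw [mul_one, Nat.cast_succ, mul_div_cancel_left₀ _ this] at h1
    exact h1.hasDerivWithinAt
  have hbd : ∀ t ∈ uIcc x₀ x, ‖y' t - ∑ k ∈ Finset.range n, (t - x₀) ^ k • c k‖ ≤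
      C * |x - x₀| ^ n := by
    intro t ht
    refine (h t (hsub ht)).trans ?_
    have : |t - x₀| ≤ |x - x₀| := abs_sub_left_of_mem_uIcc ht
    gcongr
  have := (convex_uIcc x₀ x).norm_image_sub_le_of_norm_hasDerivWithin_le hder hbd
    left_mem_uIcc right_mem_uIcc
  have e : f x - f x₀ =
      y x - y x₀ - ∑ k ∈ Finset.range n, ((x - x₀) ^ (k + 1) / (k + 1)) • c k := by
    simp only [hf, sub_self]
    simp
    abel
  rw [e, Real.norm_eq_abs] at this
  rw [pow_succ]
  linarith

/-- Induction through the derivative. The constant does not depend on the centre x₀ and also bounds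
the coefficients; both are needed when the Jacobian is expanded on every element. -/
theorem exists_uniform_taylor (hab : a < b) (n : ℕ) :
    ∀ {f : ℝ → E}, ContDiffOn ℝ ∞ f (Icc a b) → ∃ C : ℝ, 0 ≤ C ∧ ∀ x₀ ∈ Icc a b,
      ∃ c : ℕ → E, (∀ k, ‖c k‖ ≤ C) ∧ ∀ x ∈ Icc a b,
        ‖f x - ∑ k ∈ Finset.range n, (x - x₀) ^ k • c k‖ ≤ C * |x - x₀| ^ n := by
  induction n with
  | zero =>
    intro f hf
    obtain ⟨C, hC⟩ := isCompact_Icc.exists_bound_of_continuousOn hf.continuousOn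
    refine ⟨max C 0, le_max_right _ _, fun x₀ _ => ⟨0, by simp, fun x hx => ?_⟩⟩
    simpa using Or.inl (hC x hx)
  | succ n ih =>
    intro f hf
    have hu := uniqueDiffOn_Icc hab
    have hf' : ContDiffOn ℝ ∞ (derivWithin f (Icc a b)) (Icc a b) :=
      ((contDiffOn_infty_iff_derivWithin hu).1 hf).2
    obtain ⟨C, hC0, hC⟩ := ih hf'
    obtain ⟨M, hM⟩ := isCompact_Icc.exists_bound_of_continuousOn hf.continuousOn
    refine ⟨max C M, le_max_of_le_left hC0, fun x₀ hx₀ => ?_⟩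
    obtain ⟨c, hc, hc'⟩ := hC x₀ hx₀
    -- The coefficients of f are f x₀ followed by those of its derivative, shifted by one and
    -- divided by k + 1.
    refine ⟨fun k => Nat.casesOn k (f x₀) fun k => (1 / ((k : ℝ) + 1)) • c k, ?_, ?_⟩
    · rintro (_ | k)
      · exact le_max_of_le_right (hM x₀ hx₀)
      · refine le_max_of_le_left ?_
        simp only [norm_smul]
        refine (mul_le_of_le_one_left (norm_nonneg _) ?_).trans (hc k)
        rw [Real.norm_of_nonneg (by positivity), div_le_one (by positivity)]
        linarith [k.cast_nonneg (α := ℝ)]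
    · intro x hx
      have := norm_sub_sum_pow_smul_le
        (fun t ht => (hf.differentiableOn (by simp) t ht).hasDerivWithinAt) hx₀ hC0 hc' hx
      rw [Finset.sum_range_succ']
      have e : f x - (∑ k ∈ Finset.range n, (x - x₀) ^ (k + 1) • (1 / ((k : ℝ) + 1)) • c k +
          (x - x₀) ^ 0 • f x₀) =
          f x - f x₀ - ∑ k ∈ Finset.range n, ((x - x₀) ^ (k + 1) / (k + 1)) • c k := by
        simp only [smul_smul, mul_one_div, pow_zero, one_smul]
        abel
      refine (le_of_eq_of_le (congrArg _ e) this).trans ?_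
      gcongr
      exact le_max_left _ _

/-- Quadrature-type functionals that are exact on polynomials of degree at most `n`. -/
theorem norm_functional_le {ι : Type*} [Fintype ι] {ξ : ι → ℝ} (hξ0 : ∀ i, 0 ≤ ξ i)
    (hξ1 : ∀ i, ξ i ≤ 1) {y y' : ℝ → E}
    (hy : ∀ x ∈ Icc a b, HasDerivWithinAt y (y' x) (Icc a b) x)
    {n : ℕ} {x₀ h : ℝ} (hx₀ : a ≤ x₀) (hh : 0 ≤ h) (hb : x₀ + h ≤ b) {c : ℕ → E} {C : ℝ}
    (hC : 0 ≤ C)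
    (hc : ∀ x ∈ Icc a b, ‖y' x - ∑ k ∈ Finset.range n, (x - x₀) ^ k • c k‖ ≤ C * |x - x₀| ^ n)
    (α β : ι → ℝ)
    (hαβ : ∀ k < n, ∑ i, α i * ξ i ^ (k + 1) / (k + 1) = ∑ i, β i * ξ i ^ k) :
    ‖∑ i, α i • (y (x₀ + h * ξ i) - y x₀) - h • ∑ i, β i • y' (x₀ + h * ξ i)‖ ≤
      ((∑ i, |α i|) + ∑ i, |β i|) * C * h ^ (n + 1) := by
  have hmem : ∀ i, x₀ + h * ξ i ∈ Icc a b := fun i =>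
    ⟨by nlinarith [mul_nonneg hh (hξ0 i)], by nlinarith [mul_le_mul_of_nonneg_left (hξ1 i) hh]⟩
  have hx₀' : x₀ ∈ Icc a b := ⟨hx₀, by linarith⟩
  have habs : ∀ i, |x₀ + h * ξ i - x₀| ≤ h := fun i => by
    rw [add_sub_cancel_left, abs_of_nonneg (mul_nonneg hh (hξ0 i))]
    nlinarith [mul_le_mul_of_nonneg_left (hξ1 i) hh]
  set A : ι → E := fun i => y (x₀ + h * ξ i) - y x₀ -
    ∑ k ∈ Finset.range n, ((x₀ + h * ξ i - x₀) ^ (k + 1) / (k + 1)) • c k with hA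
  set B : ι → E := fun i => y' (x₀ + h * ξ i) -
    ∑ k ∈ Finset.range n, (x₀ + h * ξ i - x₀) ^ k • c k with hB
  have hAn : ∀ i, ‖A i‖ ≤ C * h ^ (n + 1) := fun i =>
    (norm_sub_sum_pow_smul_le hy hx₀' hC hc (hmem i)).trans (by gcongr; exact habs i)
  have hBn : ∀ i, ‖B i‖ ≤ C * h ^ n := fun i =>
    (hc _ (hmem i)).trans (by gcongr; exact habs i)
  -- Exactness cancels the Taylor polynomials of y and y' against each other, so that only the
  -- remainders A and B survive.
  have key : ∑ i, α i • ∑ k ∈ Finset.range n, ((x₀ + h * ξ i - x₀) ^ (k + 1) / (k + 1)) • c k =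
      h • ∑ i, β i • ∑ k ∈ Finset.range n, (x₀ + h * ξ i - x₀) ^ k • c k := by
    simp only [Finset.smul_sum, smul_smul, add_sub_cancel_left]
    rw [Finset.sum_comm]
    conv_rhs => rw [Finset.sum_comm]
    refine Finset.sum_congr rfl fun k hk => ?_
    rw [← Finset.sum_smul, ← Finset.sum_smul]
    congr 1
    have := congrArg (fun t => h ^ (k + 1) * t) (hαβ k (Finset.mem_range.1 hk))
    simp only [Finset.mul_sum] at this
    convert this using 2
    · rw [mul_pow]; ring
    · rw [mul_pow]; ring
  have e : ∑ i, α i • (y (x₀ + h * ξ i) - y x₀) - h • ∑ i, β i • y' (x₀ + h * ξ i) =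
      ∑ i, α i • A i - h • ∑ i, β i • B i := by
    simp only [hA, hB, smul_sub _ _ (Finset.sum _ _), Finset.sum_sub_distrib, key]
    abel
  rw [e]
  have h1 : ‖∑ i, α i • A i‖ ≤ (∑ i, |α i|) * (C * h ^ (n + 1)) := by
    rw [Finset.sum_mul]
    refine norm_sum_le_of_le _ fun i _ => ?_
    rw [norm_smul, Real.norm_eq_abs]
    exact mul_le_mul_of_nonneg_left (hAn i) (abs_nonneg _)
  have h2 : ‖∑ i, β i • B i‖ ≤ (∑ i, |β i|) * (C * h ^ n) := by
    rw [Finset.sum_mul]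
    refine norm_sum_le_of_le _ fun i _ => ?_
    rw [norm_smul, Real.norm_eq_abs]
    exact mul_le_mul_of_nonneg_left (hBn i) (abs_nonneg _)
  calc _ ≤ ‖∑ i, α i • A i‖ + ‖h • ∑ i, β i • B i‖ := norm_sub_le _ _
    _ ≤ (∑ i, |α i|) * (C * h ^ (n + 1)) + h * ((∑ i, |β i|) * (C * h ^ n)) := by
        rw [norm_smul, Real.norm_of_nonneg hh]
        gcongr
    _ = _ := by ring

end Taylor

/-! ### Defects of the exact solution -/

section Defect

variable {E : Type*} [NormedAddCommGroup E] [NormedSpace ℝ E] {a b : ℝ} {p : ℕ}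
  {ξ : Fin (p + 1) → ℝ}

/-- The defect of a function `y` with derivative `y'` in the collocation equations on an element
of width `h` with left end `x₀`. -/
noncomputable def stageDefect (ξ : Fin (p + 1) → ℝ) (y y' : ℝ → E) (x₀ h : ℝ)
    (i : Fin (p + 1)) : E :=
  y (x₀ + h * ξ i) - y x₀ - h • ∑ j, intMatrix ξ i j • y' (x₀ + h * ξ j)

/-- Each bound is `norm_functional_le` for a functional with its own degree of exactness. Rows of
the integration matrix are exact up to degree p; the last row is the Gauss-Lobatto rule, exact below
degree 2p; and D(p - 1) turns the q-th moment into a functional on y and y' whose exactness only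
uses the rule on powers up to 2p - 1. -/
theorem exists_stageDefect_le (hab : a < b) (hp : 1 ≤ p) (hξ : IsGaussLobatto p ξ) {y y' : ℝ → E}
    (hy : ∀ x ∈ Icc a b, HasDerivWithinAt y (y' x) (Icc a b) x)
    (hy' : ContDiffOn ℝ ∞ y' (Icc a b)) :
    ∃ C : ℝ, 0 ≤ C ∧ ∀ x₀ h : ℝ, a ≤ x₀ → 0 ≤ h → x₀ + h ≤ b →
      (∀ i, ‖stageDefect ξ y y' x₀ h i‖ ≤ C * h ^ (p + 2)) ∧
      ‖stageDefect ξ y y' x₀ h (Fin.last p)‖ ≤ C * h ^ (2 * p + 1) ∧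
      ∀ q, q + 2 ≤ p → ‖∑ i, (quadWeight ξ i * ξ i ^ q) • stageDefect ξ y y' x₀ h i‖ ≤
        C * h ^ (2 * p - q) := by
  have hT : ∀ n : ℕ, ∃ C : ℝ, 0 ≤ C ∧ ∀ α β : Fin (p + 1) → ℝ,
      (∀ k < n, ∑ i, α i * ξ i ^ (k + 1) / (k + 1) = ∑ i, β i * ξ i ^ k) →
      ∀ x₀ h : ℝ, a ≤ x₀ → 0 ≤ h → x₀ + h ≤ b →
      ‖∑ i, α i • (y (x₀ + h * ξ i) - y x₀) - h • ∑ i, β i • y' (x₀ + h * ξ i)‖ ≤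
        ((∑ i, |α i|) + ∑ i, |β i|) * C * h ^ (n + 1) := by
    intro n
    obtain ⟨C, hC, h⟩ := exists_uniform_taylor hab n hy'
    refine ⟨C, hC, fun α β hαβ x₀ h' hx₀ hh hb => ?_⟩
    obtain ⟨c, -, hc⟩ := h x₀ ⟨hx₀, by linarith⟩
    exact norm_functional_le (hξ.nonneg hp) (hξ.le_one hp) hy hx₀ hh hb hC hc α β hαβ
  choose T hT0 hT using hT
  have hstage : ∀ i x₀ h, stageDefect ξ y y' x₀ h i =
      ∑ j, (Pi.single i 1 : Fin (p + 1) → ℝ) j • (y (x₀ + h * ξ j) - y x₀) -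
        h • ∑ j, intMatrix ξ i j • y' (x₀ + h * ξ j) := by
    intro i x₀ h
    simp [stageDefect, Pi.single_apply, ite_smul]
  set C₁ : Fin (p + 1) → ℕ → ℝ := fun i n =>
    ((∑ j, |(Pi.single i 1 : Fin (p + 1) → ℝ) j|) + ∑ j, |intMatrix ξ i j|) * T n with hC₁
  have hC₁0 : ∀ i n, 0 ≤ C₁ i n := fun i n => mul_nonneg (by positivity) (hT0 n)
  set C₂ : ℕ → ℝ := fun q => ((∑ j, |quadWeight ξ j * ξ j ^ q|) +
    ∑ j, |quadWeight ξ j * (1 - ξ j ^ (q + 1)) / (q + 1)|) * T (2 * p - q - 1) with hC₂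
  have hC₂0 : ∀ q, 0 ≤ C₂ q := fun q => mul_nonneg (by positivity) (hT0 _)
  refine ⟨∑ i, C₁ i (p + 1) + C₁ (Fin.last p) (2 * p) + ∑ q ∈ Finset.range p, C₂ q, ?_, ?_⟩
  · have := Finset.sum_nonneg fun i (_ : i ∈ Finset.univ) => hC₁0 i (p + 1)
    have := Finset.sum_nonneg fun i (_ : i ∈ Finset.range p) => hC₂0 i
    have := hC₁0 (Fin.last p) (2 * p)
    positivity
  intro x₀ h hx₀ hh hb
  have s1 : 0 ≤ ∑ i, C₁ i (p + 1) := Finset.sum_nonneg fun i _ => hC₁0 i (p + 1)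
  have s2 : 0 ≤ ∑ q ∈ Finset.range p, C₂ q := Finset.sum_nonneg fun i _ => hC₂0 i
  have s3 := hC₁0 (Fin.last p) (2 * p)
  refine ⟨fun i => ?_, ?_, fun q hq => ?_⟩
  · rw [hstage]
    refine (hT (p + 1) _ _ (fun k hk => ?_) x₀ h hx₀ hh hb).trans ?_
    · rw [sum_intMatrix_mul_pow hξ.1.injective (by omega)]
      simp [Pi.single_apply, ← Finset.sum_div]
    · have : C₁ i (p + 1) ≤ ∑ i, C₁ i (p + 1) :=
        Finset.single_le_sum (f := fun i => C₁ i (p + 1)) (fun i _ => hC₁0 i _) (Finset.mem_univ i)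
      refine mul_le_mul_of_nonneg_right ?_ (by positivity)
      linarith
  · rw [hstage]
    refine (hT (2 * p) _ _ (fun k hk => ?_) x₀ h hx₀ hh hb).trans ?_
    · have := hξ.sum_quadWeight_mul_pow hp hk
      simp [Pi.single_apply, ← Finset.sum_div, hξ.intMatrix_last hp, this, hξ.last hp]
    · refine mul_le_mul_of_nonneg_right ?_ (by positivity)
      linarith
  · have e : ∑ i, (quadWeight ξ i * ξ i ^ q) • stageDefect ξ y y' x₀ h i =
        ∑ i, (quadWeight ξ i * ξ i ^ q) • (y (x₀ + h * ξ i) - y x₀) -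
          h • ∑ j, (quadWeight ξ j * (1 - ξ j ^ (q + 1)) / (q + 1)) • y' (x₀ + h * ξ j) := by
      simp only [stageDefect, smul_sub _ _ (h • _), Finset.sum_sub_distrib]
      congr 1
      simp only [Finset.smul_sum, smul_smul]
      rw [Finset.sum_comm]
      refine Finset.sum_congr rfl fun j _ => ?_
      rw [← Finset.sum_smul, ← hξ.sum_quadWeight_mul_pow_mul_intMatrix hp hq, Finset.mul_sum]
      congr 1
      exact Finset.sum_congr rfl fun i _ => by ring
    rw [e]
    have hn : 2 * p - q - 1 + 1 = 2 * p - q := by omega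
    rw [← hn]
    refine (hT (2 * p - q - 1) _ _ (fun k hk => ?_) x₀ h hx₀ hh hb).trans ?_
    · have h1 := hξ.sum_quadWeight_mul_pow hp (d := q + (k + 1)) (by omega)
      have h2 := hξ.sum_quadWeight_mul_pow hp (d := k) (by omega)
      have e1 : ∑ i, quadWeight ξ i * ξ i ^ q * ξ i ^ (k + 1) / ((k : ℝ) + 1) =
          (1 / ((q + (k + 1) : ℕ) + 1 : ℝ)) / (k + 1) := by
        rw [← h1, Finset.sum_div]
        exact Finset.sum_congr rfl fun i _ => by rw [pow_add]; ring
      have e2 : ∑ j, quadWeight ξ j * (1 - ξ j ^ (q + 1)) / ((q : ℝ) + 1) * ξ j ^ k =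
          (1 / ((k : ℝ) + 1) - 1 / ((q + (k + 1) : ℕ) + 1 : ℝ)) / (q + 1) := by
        rw [← h1, ← h2, ← Finset.sum_sub_distrib, Finset.sum_div]
        exact Finset.sum_congr rfl fun i _ => by ring
      rw [e1, e2]
      push_cast
      have : (q : ℝ) + 1 ≠ 0 := by positivity
      have : (k : ℝ) + 1 ≠ 0 := by positivity
      have : (q : ℝ) + (k + 1) + 1 ≠ 0 := by positivity
      field_simp
      ring
    · have : C₂ q ≤ ∑ q ∈ Finset.range p, C₂ q :=
        Finset.single_le_sum (f := C₂) (fun i _ => hC₂0 i) (Finset.mem_range.2 (by omega))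
      refine mul_le_mul_of_nonneg_right ?_ (by positivity)
      linarith

end Defect

/-! ### Recursive bounds for the moments of the error -/

/-- The factor h^k pays exactly for the k powers of h that the bound on the moment of index d + k
lacks. -/
theorem moment_source_le {p : ℕ} {K C : ℝ} (hK : 0 ≤ K) (hC : 0 ≤ C) {ε h : ℝ} (hε : 0 ≤ ε)
    (h0 : 0 ≤ h) (h1 : h ≤ 1) {Q Z : ℕ → ℝ} {n : ℕ}
    (hZ : ∀ d, Z d ≤ K * (∑ k ∈ Finset.range p, h ^ k * Q (d + k) + ε + h ^ (2 * p)))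
    (hQ : ∀ d, Q d ≤ C * (ε + h ^ n + h ^ (2 * p - d))) (d : ℕ) :
    Z d ≤ K * (p * C + 1) * (ε + h ^ n + h ^ (2 * p - d)) := by
  set B := ε + h ^ n + h ^ (2 * p - d) with hB
  have hterm : ∀ k ∈ Finset.range p, h ^ k * Q (d + k) ≤ C * B := by
    intro k _
    have hk1 : h ^ k ≤ 1 := pow_le_one₀ h0 h1
    calc h ^ k * Q (d + k) ≤ h ^ k * (C * (ε + h ^ n + h ^ (2 * p - (d + k)))) := by
          gcongr; exact hQ _
      _ = C * (h ^ k * ε + h ^ k * h ^ n + h ^ (k + (2 * p - (d + k)))) := by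
          rw [pow_add]; ring
      _ ≤ C * B := by
          have e1 : h ^ k * ε ≤ ε := mul_le_of_le_one_left hε hk1
          have e2 : h ^ k * h ^ n ≤ h ^ n := mul_le_of_le_one_left (by positivity) hk1
          have e3 : h ^ (k + (2 * p - (d + k))) ≤ h ^ (2 * p - d) :=
            pow_le_pow_of_le_one h0 h1 (by omega)
          rw [hB]
          gcongr
  have hsum : ∑ k ∈ Finset.range p, h ^ k * Q (d + k) ≤ p * (C * B) := by
    refine (Finset.sum_le_card_nsmul _ _ _ hterm).trans_eq ?_
    simp
  have e : ε + h ^ (2 * p) ≤ B := by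
    have : h ^ (2 * p) ≤ h ^ (2 * p - d) := pow_le_pow_of_le_one h0 h1 (by omega)
    have : 0 ≤ h ^ n := by positivity
    linarith
  calc Z d ≤ K * (∑ k ∈ Finset.range p, h ^ k * Q (d + k) + ε + h ^ (2 * p)) := hZ d
    _ ≤ K * (p * (C * B) + B) := mul_le_mul_of_nonneg_left (by linarith) hK
    _ = _ := by ring

/-- Bootstrap in n: Q denotes norms of moments of the stage errors, Z those of the source errors. A
bound on Q passes to Z without loss and returns to Q with a factor h, until h^n is negligible beside
h^(2p-d). -/
theorem exists_moment_bound (p : ℕ) {K : ℝ} (hK : 0 ≤ K) (n : ℕ) :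
    ∃ C : ℝ, 0 ≤ C ∧ ∀ ε h : ℝ, 0 ≤ ε → 0 ≤ h → h ≤ 1 → ∀ Q Z : ℕ → ℝ,
      (∀ d, Q d ≤ K * (ε + h ^ (p + 2))) →
      (∀ q, q + 2 ≤ p → Q q ≤ ε + h * (Z 0 + Z (q + 1)) + K * h ^ (2 * p - q)) →
      (∀ d, Z d ≤ K * (∑ k ∈ Finset.range p, h ^ k * Q (d + k) + ε + h ^ (2 * p))) →
      ∀ d, Q d ≤ C * (ε + h ^ n + h ^ (2 * p - d)) := by
  induction n with
  | zero =>
    refine ⟨K, hK, fun ε h hε h0 h1 Q Z hQ _ _ d => (hQ d).trans ?_⟩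
    have : h ^ (p + 2) ≤ 1 := pow_le_one₀ h0 h1
    have : 0 ≤ h ^ (2 * p - d) := by positivity
    rw [pow_zero]
    exact mul_le_mul_of_nonneg_left (by linarith) hK
  | succ n ih =>
    obtain ⟨C, hC, ih⟩ := ih
    set R := K * (p * C + 1) with hR
    have hR0 : 0 ≤ R := by positivity
    refine ⟨1 + 2 * R + K, by positivity, fun ε h hε h0 h1 Q Z hQ hQZ hZ d => ?_⟩
    by_cases hd : d + 2 ≤ p
    · have hZ' := moment_source_le hK hC hε h0 h1 hZ (ih ε h hε h0 h1 Q Z hQ hQZ hZ)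
      have z0 := hZ' 0
      have z1 := hZ' (d + 1)
      rw [← hR] at z0 z1
      have e1 : h * ε ≤ ε := mul_le_of_le_one_left hε h1
      have e2 : h * h ^ (2 * p - 0) ≤ h ^ (2 * p - d) := by
        rw [← pow_succ']
        exact pow_le_pow_of_le_one h0 h1 (by omega)
      have e3 : h * h ^ (2 * p - (d + 1)) ≤ h ^ (2 * p - d) := by
        rw [← pow_succ']
        exact pow_le_pow_of_le_one h0 h1 (by omega)
      have f : 0 ≤ h ^ (n + 1) := by positivity
      have f' : 0 ≤ h ^ (2 * p - d) := by positivity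
      calc Q d ≤ ε + h * (Z 0 + Z (d + 1)) + K * h ^ (2 * p - d) := hQZ d hd
        _ ≤ ε + h * (R * (ε + h ^ n + h ^ (2 * p - 0)) + R * (ε + h ^ n + h ^ (2 * p - (d + 1)))) +
            K * h ^ (2 * p - d) := by gcongr
        _ = ε + R * (h * ε + h ^ (n + 1) + h * h ^ (2 * p - 0) +
              (h * ε + h ^ (n + 1) + h * h ^ (2 * p - (d + 1)))) + K * h ^ (2 * p - d) := by
            rw [pow_succ]; ring
        _ ≤ ε + R * (ε + h ^ (n + 1) + h ^ (2 * p - d) + (ε + h ^ (n + 1) + h ^ (2 * p - d))) +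
            K * h ^ (2 * p - d) := by gcongr
        _ ≤ _ := by nlinarith [mul_nonneg hK hε, mul_nonneg hK f]
    -- For these d no moment identity is available, but 2p - d ≤ p + 1 and the crude stage bound
    -- already suffices.
    · have e : h ^ (p + 2) ≤ h ^ (2 * p - d) := pow_le_pow_of_le_one h0 h1 (by omega)
      have f : 0 ≤ h ^ (n + 1) := by positivity
      calc Q d ≤ K * (ε + h ^ (p + 2)) := hQ d
        _ ≤ (1 + 2 * R + K) * (ε + h ^ (n + 1) + h ^ (2 * p - d)) := by
          gcongr
          · linarith
          · linarith

/-! ### The local error of the collocation method -/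

section LocalError

variable {E : Type*} [NormedAddCommGroup E] [NormedSpace ℝ E] {a b r L : ℝ} {p : ℕ}
  {ξ : Fin (p + 1) → ℝ} {g : E → ℝ → E} {y : ℝ → E} {J : ℝ → E →L[ℝ] E}

/-- The right-hand side `g w x` of an ordinary differential equation, in a tube of radius `r`
around its solution `y` and in terms of the deviation `w` from `y x`; `J` is its derivative
along the solution. -/
structure IsSmoothTube (a b r L : ℝ) (g : E → ℝ → E) (y : ℝ → E) (J : ℝ → E →L[ℝ] E) : Prop where
  radius_pos : 0 < r
  const_nonneg : 0 ≤ L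
  ode : ∀ x ∈ Icc a b, HasDerivWithinAt y (g 0 x) (Icc a b) x
  smooth : ContDiffOn ℝ ∞ (g 0) (Icc a b)
  smooth_deriv : ContDiffOn ℝ ∞ J (Icc a b)
  bound : ∀ x ∈ Icc a b, ∀ w : E, ‖w‖ ≤ r → ‖g w x‖ ≤ L
  lipschitz : ∀ x ∈ Icc a b, ∀ w w' : E, ‖w‖ ≤ r → ‖w'‖ ≤ r → ‖g w x - g w' x‖ ≤ L * ‖w - w'‖
  quadratic : ∀ x ∈ Icc a b, ∀ w : E, ‖w‖ ≤ r → ‖g w x - g 0 x - J x w‖ ≤ L * ‖w‖ ^ 2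

/-- The stage equations of the collocation method on the element `[x₀, x₀ + h]`, in terms of
the deviations `e` from the solution `y`. -/
def IsStageError (ξ : Fin (p + 1) → ℝ) (g : E → ℝ → E) (y : ℝ → E) (x₀ h : ℝ)
    (e : Fin (p + 1) → E) : Prop :=
  ∀ i, y (x₀ + h * ξ i) + e i = y x₀ + e 0 + h • ∑ j, intMatrix ξ i j • g (e j) (x₀ + h * ξ j)

theorem IsStageError.eq {x₀ h : ℝ} {e : Fin (p + 1) → E} (he : IsStageError ξ g y x₀ h e)
    (i : Fin (p + 1)) :
    e i = e 0 + h • ∑ j, intMatrix ξ i j • (g (e j) (x₀ + h * ξ j) - g 0 (x₀ + h * ξ j)) -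
      stageDefect ξ y (g 0) x₀ h i := by
  have := he i
  simp only [stageDefect, smul_sub, Finset.sum_sub_distrib]
  rw [← sub_eq_iff_eq_add'] at this
  rw [← this]
  abel

theorem norm_sum_smul_le {ι : Type*} [Fintype ι] (c : ι → ℝ) {v : ι → E} {B : ℝ}
    (hv : ∀ i, ‖v i‖ ≤ B) : ‖∑ i, c i • v i‖ ≤ (∑ i, |c i|) * B := by
  rw [Finset.sum_mul]
  refine norm_sum_le_of_le _ fun i _ => ?_
  rw [norm_smul, Real.norm_eq_abs]
  exact mul_le_mul_of_nonneg_left (hv i) (abs_nonneg _)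

/-- A bound for the row sums of the integration matrix and for the quadrature weights. -/
noncomputable def weightBound (ξ : Fin (p + 1) → ℝ) : ℝ :=
  1 + ∑ i, ∑ j, |intMatrix ξ i j| + ∑ i, |quadWeight ξ i|

theorem one_le_weightBound (ξ : Fin (p + 1) → ℝ) : 1 ≤ weightBound ξ := by
  have h1 : 0 ≤ ∑ i, ∑ j, |intMatrix ξ i j| := by positivity
  have h2 : 0 ≤ ∑ i, |quadWeight ξ i| := by positivity
  rw [weightBound]
  linarith

theorem sum_abs_intMatrix_le (ξ : Fin (p + 1) → ℝ) (i : Fin (p + 1)) :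
    ∑ j, |intMatrix ξ i j| ≤ weightBound ξ := by
  have h1 : ∑ j, |intMatrix ξ i j| ≤ ∑ i, ∑ j, |intMatrix ξ i j| :=
    Finset.single_le_sum (f := fun i => ∑ j, |intMatrix ξ i j|) (fun i _ => by positivity)
      (Finset.mem_univ i)
  have h2 : 0 ≤ ∑ i, |quadWeight ξ i| := by positivity
  rw [weightBound]
  linarith

theorem sum_abs_quadWeight_le (ξ : Fin (p + 1) → ℝ) : ∑ j, |quadWeight ξ j| ≤ weightBound ξ := by
  have h1 : 0 ≤ ∑ i, ∑ j, |intMatrix ξ i j| := by positivity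
  rw [weightBound]
  linarith

theorem norm_sum_intMatrix_smul_le (i : Fin (p + 1)) {v : Fin (p + 1) → E} {B : ℝ} (hB : 0 ≤ B)
    (hv : ∀ i, ‖v i‖ ≤ B) : ‖∑ j, intMatrix ξ i j • v j‖ ≤ weightBound ξ * B :=
  (norm_sum_smul_le _ hv).trans (mul_le_mul_of_nonneg_right (sum_abs_intMatrix_le ξ i) hB)

theorem IsGaussLobatto.norm_sum_quadWeight_mul_pow_smul_le (hξ : IsGaussLobatto p ξ) (hp : 1 ≤ p)
    (d : ℕ) {v : Fin (p + 1) → E} {B : ℝ} (hB : 0 ≤ B) (hv : ∀ i, ‖v i‖ ≤ B) :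
    ‖∑ j, (quadWeight ξ j * ξ j ^ d) • v j‖ ≤ weightBound ξ * B := by
  refine (norm_sum_smul_le _ hv).trans (mul_le_mul_of_nonneg_right ?_ hB)
  refine le_trans (Finset.sum_le_sum fun j _ => ?_) (sum_abs_quadWeight_le ξ)
  rw [abs_mul]
  refine mul_le_of_le_one_right (abs_nonneg _) ?_
  rw [abs_of_nonneg (pow_nonneg (hξ.nonneg hp j) d)]
  exact pow_le_one₀ (hξ.nonneg hp j) (hξ.le_one hp j)

theorem IsGaussLobatto.node_mem (hξ : IsGaussLobatto p ξ) (hp : 1 ≤ p) {x₀ h : ℝ} (hx₀ : a ≤ x₀)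
    (hh : 0 ≤ h) (hb : x₀ + h ≤ b) (i : Fin (p + 1)) : x₀ + h * ξ i ∈ Icc a b :=
  ⟨by nlinarith [mul_nonneg hh (hξ.nonneg hp i)],
    by nlinarith [mul_le_mul_of_nonneg_left (hξ.le_one hp i) hh]⟩

-- The stages are first bounded by absorbing the Lipschitz term. Their moments then satisfy the
-- hypotheses of `exists_moment_bound`, and the endpoint error is e 0 plus h times the zeroth moment
-- of the source error, minus the endpoint defect.
set_option maxHeartbeats 1000000 in
theorem IsStageError.exists_le (hab : a < b) (hp : 1 ≤ p) (hξ : IsGaussLobatto p ξ)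
    (ht : IsSmoothTube a b r L g y J) :
    ∃ C : ℝ, 0 ≤ C ∧ ∀ x₀ h : ℝ, a ≤ x₀ → 0 ≤ h → h ≤ 1 → h * (weightBound ξ * L) ≤ 1 / 2 →
      x₀ + h ≤ b → ∀ e : Fin (p + 1) → E, (∀ i, ‖e i‖ ≤ r) → IsStageError ξ g y x₀ h e →
      (∀ i, ‖e i‖ ≤ C * (‖e 0‖ + h ^ (p + 2))) ∧
      ‖e (Fin.last p)‖ ≤ (1 + C * h) * ‖e 0‖ + C * h ^ (2 * p + 1) := by
  obtain ⟨D, hD0, hD⟩ := exists_stageDefect_le hab hp hξ ht.ode ht.smooth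
  obtain ⟨T, hT0, hT⟩ := exists_uniform_taylor hab p ht.smooth_deriv
  have hL := ht.const_nonneg
  have hr := ht.radius_pos.le
  set W := weightBound ξ with hW
  have hW1 : 1 ≤ W := one_le_weightBound ξ
  have hW0 : 0 ≤ W := by linarith
  set M := 2 * (1 + D) with hM
  have hM0 : 0 ≤ M := by positivity
  -- The three groups of summands serve the crude bound on Q, the bound of Q by Z, and the bound of
  -- Z by Q.
  set K := W * M + D + (T + W * (T * M + L * (2 * M ^ 2 * (r + 1)))) with hK
  have hK0 : 0 ≤ K := by positivity
  obtain ⟨C, hC0, hC⟩ := exists_moment_bound p hK0 (2 * p)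
  refine ⟨M + D + 2 * (K * (p * C + 1)), by positivity, ?_⟩
  intro x₀ h hx₀ h0 h1 hhL hb e her he
  obtain ⟨hD1, hD2, hD3⟩ := hD x₀ h hx₀ h0 hb
  have hmem := hξ.node_mem hp hx₀ h0 hb
  set x : Fin (p + 1) → ℝ := fun i => x₀ + h * ξ i with hx
  set z : Fin (p + 1) → E := fun j => g (e j) (x j) - g 0 (x j) with hz
  set d := stageDefect ξ y (g 0) x₀ h with hd
  have heq : ∀ i, e i = e 0 + h • ∑ j, intMatrix ξ i j • z j - d i := he.eq
  set ε := ‖e 0‖ with hε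
  have hε0 : 0 ≤ ε := norm_nonneg _
  have hεr : ε ≤ r := her 0
  set m := ‖e‖ with hm
  have hm0 : 0 ≤ m := norm_nonneg _
  have hem : ∀ i, ‖e i‖ ≤ m := norm_le_pi_norm e
  have hz1 : ∀ j, ‖z j‖ ≤ L * m := by
    intro j
    refine (ht.lipschitz (x j) (hmem j) (e j) 0 (her j) (by simpa using hr)).trans ?_
    rw [sub_zero]
    exact mul_le_mul_of_nonneg_left (hem j) hL
  have hmle : m ≤ M * (ε + h ^ (p + 2)) := by
    have : m ≤ ε + h * (W * (L * m)) + D * h ^ (p + 2) := by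
      refine (pi_norm_le_iff_of_nonneg (by positivity)).2 fun i => ?_
      rw [heq i]
      refine (norm_sub_le _ _).trans (add_le_add ((norm_add_le _ _).trans (add_le_add le_rfl ?_))
        (hD1 i))
      rw [norm_smul, Real.norm_of_nonneg h0]
      exact mul_le_mul_of_nonneg_left
        (norm_sum_intMatrix_smul_le i (by positivity) hz1) h0
    have h3 : h * (W * (L * m)) ≤ 1 / 2 * m := by
      calc h * (W * (L * m)) = h * (W * L) * m := by ring
        _ ≤ _ := mul_le_mul_of_nonneg_right hhL hm0
    have h4 : 0 ≤ h ^ (p + 2) := by positivity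
    rw [hM]
    nlinarith [mul_nonneg hD0 hε0]
  -- the moments of the error and of its image under the right-hand side
  set Qv : ℕ → E := fun q => ∑ j, (quadWeight ξ j * ξ j ^ q) • e j with hQv
  set Zv : ℕ → E := fun q => ∑ j, (quadWeight ξ j * ξ j ^ q) • z j with hZv
  have hQ1 : ∀ q, ‖Qv q‖ ≤ K * (ε + h ^ (p + 2)) := by
    intro q
    have h4 : 0 ≤ h ^ (p + 2) := by positivity
    refine (hξ.norm_sum_quadWeight_mul_pow_smul_le hp q hm0 hem).trans ?_
    calc W * m ≤ W * (M * (ε + h ^ (p + 2))) := by gcongr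
      _ = W * M * (ε + h ^ (p + 2)) := by ring
      _ ≤ K * (ε + h ^ (p + 2)) := by
        gcongr
        rw [hK, add_assoc]
        exact le_add_of_nonneg_right (by positivity)
  have hQ2 : ∀ q, q + 2 ≤ p →
      ‖Qv q‖ ≤ ε + h * (‖Zv 0‖ + ‖Zv (q + 1)‖) + K * h ^ (2 * p - q) := by
    intro q hq
    have hq0 : (0 : ℝ) < (q : ℝ) + 1 := by positivity
    have hq1 : 1 / ((q : ℝ) + 1) ≤ 1 := by
      rw [div_le_one hq0]; linarith [q.cast_nonneg (α := ℝ)]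
    -- Taking the q-th moment of the stage equations, D(p - 1) replaces the moment of the
    -- integration matrix by (w_j - w_j ξ_j^(q+1)) / (q + 1), that is, by the moments of z of orders
    -- 0 and q + 1.
    have e1 : Qv q = (1 / ((q : ℝ) + 1)) • e 0 + h • (1 / ((q : ℝ) + 1)) • (Zv 0 - Zv (q + 1)) -
        ∑ i, (quadWeight ξ i * ξ i ^ q) • d i := by
      have : Qv q = ∑ i, (quadWeight ξ i * ξ i ^ q) •
          (e 0 + h • ∑ j, intMatrix ξ i j • z j - d i) :=
        Finset.sum_congr rfl fun i _ => by rw [← heq i]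
      rw [this]
      simp only [smul_sub _ _ (d _), smul_add, Finset.sum_sub_distrib, Finset.sum_add_distrib]
      congr 2
      · rw [← Finset.sum_smul, hξ.sum_quadWeight_mul_pow hp (by omega)]
      · simp only [hZv, ← Finset.sum_sub_distrib, ← sub_smul, Finset.smul_sum, smul_smul]
        rw [Finset.sum_comm]
        refine Finset.sum_congr rfl fun j _ => ?_
        rw [← Finset.sum_smul]
        congr 1
        have := hξ.sum_quadWeight_mul_pow_mul_intMatrix hp hq j
        calc ∑ i, quadWeight ξ i * ξ i ^ q * (h * intMatrix ξ i j)
            = h * ∑ i, quadWeight ξ i * ξ i ^ q * intMatrix ξ i j := by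
              rw [Finset.mul_sum]; exact Finset.sum_congr rfl fun i _ => by ring
          _ = _ := by rw [this]; ring
    rw [e1]
    refine (norm_sub_le _ _).trans (add_le_add ((norm_add_le _ _).trans (add_le_add ?_ ?_)) ?_)
    · rw [norm_smul, Real.norm_of_nonneg (by positivity)]
      exact mul_le_of_le_one_left hε0 hq1
    · rw [norm_smul, norm_smul, Real.norm_of_nonneg h0, Real.norm_of_nonneg (by positivity)]
      exact mul_le_mul_of_nonneg_left ((mul_le_of_le_one_left (norm_nonneg _) hq1).trans
        (norm_sub_le _ _)) h0
    · refine (hD3 q hq).trans (mul_le_mul_of_nonneg_right ?_ (by positivity))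
      have : 0 ≤ W * M := by positivity
      have : 0 ≤ T + W * (T * M + L * (2 * M ^ 2 * (r + 1))) := by positivity
      linarith
  obtain ⟨c, hc, hcJ⟩ := hT x₀ ⟨hx₀, by linarith⟩
  have hZ : ∀ q, ‖Zv q‖ ≤
      K * (∑ k ∈ Finset.range p, h ^ k * ‖Qv (q + k)‖ + ε + h ^ (2 * p)) := by
    intro q
    -- The remainder collects the quadratic error of the linearization and the Taylor remainder of J
    -- applied to e j. Both are O(ε + h^(2p)): m² because ε ≤ r turns ε² into a multiple of ε, and
    -- h^p m because m is itself O(ε + h^(p+2)).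
    set rem : Fin (p + 1) → E := fun j => z j - ∑ k ∈ Finset.range p, (h * ξ j) ^ k • c k (e j)
      with hrem
    have hremle : ∀ j, ‖rem j‖ ≤ (T * M + L * (2 * M ^ 2 * (r + 1))) * (ε + h ^ (2 * p)) := by
      intro j
      have e1 : rem j = (z j - J (x j) (e j)) +
          (J (x j) - ∑ k ∈ Finset.range p, (h * ξ j) ^ k • c k) (e j) := by
        simp [hrem]
      have e2 : ‖z j - J (x j) (e j)‖ ≤ L * m ^ 2 :=
        (ht.quadratic (x j) (hmem j) (e j) (her j)).trans (by gcongr; exact hem j)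
      have e3 : ‖J (x j) - ∑ k ∈ Finset.range p, (h * ξ j) ^ k • c k‖ ≤ T * h ^ p := by
        have := hcJ (x j) (hmem j)
        simp only [hx, add_sub_cancel_left] at this
        refine this.trans ?_
        have h5 : |h * ξ j| ≤ h := by
          rw [abs_of_nonneg (mul_nonneg h0 (hξ.nonneg hp j))]
          exact mul_le_of_le_one_right h0 (hξ.le_one hp j)
        gcongr
      have e4 : m ^ 2 ≤ 2 * M ^ 2 * (r + 1) * (ε + h ^ (2 * p)) := by
        have g1 : h ^ (p + 2) ≤ h ^ p := pow_le_pow_of_le_one h0 h1 (by omega)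
        have g2 : (h ^ p) ^ 2 = h ^ (2 * p) := by rw [← pow_mul, mul_comm]
        have g0 : 0 ≤ h ^ p := by positivity
        calc m ^ 2 ≤ (M * (ε + h ^ p)) ^ 2 := by
              gcongr
              exact hmle.trans (by gcongr)
          _ = M ^ 2 * (ε + h ^ p) ^ 2 := by ring
          _ ≤ M ^ 2 * (2 * ((r + 1) * (ε + h ^ (2 * p)))) := by
              gcongr
              rw [← g2]
              nlinarith [sq_nonneg (ε - h ^ p), mul_le_mul_of_nonneg_right hεr hε0,
                mul_nonneg hr (sq_nonneg (h ^ p))]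
          _ = _ := by ring
      have e5 : h ^ p * m ≤ M * (ε + h ^ (2 * p)) := by
        have g1 : h ^ p ≤ 1 := pow_le_one₀ h0 h1
        have g2 : h ^ p * h ^ (p + 2) ≤ h ^ (2 * p) := by
          rw [← pow_add]
          exact pow_le_pow_of_le_one h0 h1 (by omega)
        calc h ^ p * m ≤ h ^ p * (M * (ε + h ^ (p + 2))) := by gcongr
          _ = M * (h ^ p * ε + h ^ p * h ^ (p + 2)) := by ring
          _ ≤ _ := by
            gcongr
            exact mul_le_of_le_one_left hε0 g1
      rw [e1]
      calc _ ≤ L * m ^ 2 + (T * h ^ p) * m :=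
            (norm_add_le _ _).trans (add_le_add e2
              ((ContinuousLinearMap.le_opNorm _ _).trans
                (mul_le_mul e3 (hem j) (norm_nonneg _) (by positivity))))
        _ = L * m ^ 2 + T * (h ^ p * m) := by ring
        _ ≤ L * (2 * M ^ 2 * (r + 1) * (ε + h ^ (2 * p))) + T * (M * (ε + h ^ (2 * p))) := by
            gcongr
        _ = _ := by ring
    have e1 : Zv q = ∑ k ∈ Finset.range p, h ^ k • c k (Qv (q + k)) +
        ∑ j, (quadWeight ξ j * ξ j ^ q) • rem j := by
      have : ∑ k ∈ Finset.range p, h ^ k • c k (Qv (q + k)) =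
          ∑ j, (quadWeight ξ j * ξ j ^ q) • ∑ k ∈ Finset.range p, (h * ξ j) ^ k • c k (e j) := by
        simp only [hQv, map_sum, map_smul, Finset.smul_sum, smul_smul]
        rw [Finset.sum_comm]
        refine Finset.sum_congr rfl fun j _ => Finset.sum_congr rfl fun k _ => ?_
        congr 1
        rw [mul_pow, pow_add]
        ring
      rw [this, ← Finset.sum_add_distrib]
      refine Finset.sum_congr rfl fun j _ => ?_
      rw [← smul_add, hrem]
      simp
    have hS : 0 ≤ ∑ k ∈ Finset.range p, h ^ k * ‖Qv (q + k)‖ :=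
      Finset.sum_nonneg fun k _ => by positivity
    have e2 : ‖∑ k ∈ Finset.range p, h ^ k • c k (Qv (q + k))‖ ≤
        T * ∑ k ∈ Finset.range p, h ^ k * ‖Qv (q + k)‖ := by
      rw [Finset.mul_sum]
      refine norm_sum_le_of_le _ fun k _ => ?_
      rw [norm_smul, Real.norm_of_nonneg (by positivity)]
      calc h ^ k * ‖c k (Qv (q + k))‖ ≤ h ^ k * (T * ‖Qv (q + k)‖) := by
            gcongr
            exact (c k).le_of_opNorm_le (hc k) _
        _ = _ := by ring
    have e3 := hξ.norm_sum_quadWeight_mul_pow_smul_le hp q (by positivity) hremle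
    rw [e1]
    set U := T * M + L * (2 * M ^ 2 * (r + 1)) with hU
    have hU0 : 0 ≤ U := by positivity
    set Sg := ∑ k ∈ Finset.range p, h ^ k * ‖Qv (q + k)‖
    have hP : 0 ≤ h ^ (2 * p) := by positivity
    have hTW : 0 ≤ T + W * U := by positivity
    calc _ ≤ T * Sg + W * (U * (ε + h ^ (2 * p))) :=
          (norm_add_le _ _).trans (add_le_add e2 e3)
      _ ≤ (T + W * U) * (Sg + ε + h ^ (2 * p)) := by
          nlinarith [mul_nonneg hT0 hε0, mul_nonneg hT0 hP, mul_nonneg (mul_nonneg hW0 hU0) hS]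
      _ ≤ K * (Sg + ε + h ^ (2 * p)) := by
          gcongr
          rw [hK]
          exact le_add_of_nonneg_left (by positivity)
  have hZ0 := moment_source_le hK0 hC0 hε0 h0 h1 hZ
    (hC ε h hε0 h0 h1 (fun q => ‖Qv q‖) (fun q => ‖Zv q‖) hQ1 hQ2 hZ) 0
  simp only [Nat.sub_zero] at hZ0
  set R := K * (p * C + 1) with hR
  have hR0 : 0 ≤ R := by positivity
  refine ⟨fun i => (hem i).trans (hmle.trans ?_), ?_⟩
  · have h4 : 0 ≤ h ^ (p + 2) := by positivity
    gcongr
    linarith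
  · have e1 : e (Fin.last p) = e 0 + h • Zv 0 - d (Fin.last p) := by
      rw [heq]
      simp [hZv, hξ.intMatrix_last hp]
    have hP : 0 ≤ h ^ (2 * p + 1) := by positivity
    rw [e1]
    calc _ ≤ ε + h * (R * (ε + h ^ (2 * p) + h ^ (2 * p))) + D * h ^ (2 * p + 1) := by
          refine (norm_sub_le _ _).trans
            (add_le_add ((norm_add_le _ _).trans (add_le_add le_rfl ?_)) hD2)
          rw [norm_smul, Real.norm_of_nonneg h0]
          gcongr
      _ = ε + R * (h * ε) + 2 * R * h ^ (2 * p + 1) + D * h ^ (2 * p + 1) := by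
          rw [pow_succ]; ring
      _ ≤ _ := by
          have : 0 ≤ h * ε := by positivity
          nlinarith [mul_nonneg hR0 this, mul_nonneg hM0 this, mul_nonneg hD0 this,
            mul_nonneg hM0 hP]

end LocalError

/-! ### Single elements: solvability, uniqueness and error propagation -/

section Element

variable {E : Type*} [NormedAddCommGroup E] [NormedSpace ℝ E] {a b r L : ℝ} {p : ℕ}
  {ξ : Fin (p + 1) → ℝ} {g : E → ℝ → E} {y : ℝ → E} {J : ℝ → E →L[ℝ] E}

theorem IsSmoothTube.norm_solution_sub_le (ht : IsSmoothTube a b r L g y J) {x x' : ℝ}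
    (hx : x ∈ Icc a b) (hx' : x' ∈ Icc a b) : ‖y x' - y x‖ ≤ L * |x' - x| :=
  (convex_Icc a b).norm_image_sub_le_of_norm_hasDerivWithin_le ht.ode
    (fun t h => ht.bound t h 0 (by simpa using ht.radius_pos.le)) hx hx'

theorem IsSmoothTube.norm_node_sub_le (ht : IsSmoothTube a b r L g y J)
    (hξ : IsGaussLobatto p ξ) (hp : 1 ≤ p) {x₀ h : ℝ}
    (hx₀ : a ≤ x₀) (h0 : 0 ≤ h) (hb : x₀ + h ≤ b) (i : Fin (p + 1)) :
    ‖y (x₀ + h * ξ i) - y x₀‖ ≤ L * h := by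
  refine (ht.norm_solution_sub_le ⟨hx₀, by linarith⟩ (hξ.node_mem hp hx₀ h0 hb i)).trans ?_
  refine mul_le_mul_of_nonneg_left ?_ ht.const_nonneg
  rw [add_sub_cancel_left, abs_of_nonneg (mul_nonneg h0 (hξ.nonneg hp i))]
  exact mul_le_of_le_one_right h0 (hξ.le_one hp i)

/-- Only the size of the source at the stages is used, so this confines an arbitrary solution to the
tube before any Lipschitz bound is available. -/
theorem IsStageError.norm_le (ht : IsSmoothTube a b r L g y J)
    (hξ : IsGaussLobatto p ξ) (hp : 1 ≤ p) {x₀ h M : ℝ}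
    (hx₀ : a ≤ x₀) (h0 : 0 ≤ h) (hb : x₀ + h ≤ b) (hM : 0 ≤ M)
    (hh : h * (weightBound ξ * M + L) ≤ r / 2) {e : Fin (p + 1) → E}
    (he : IsStageError ξ g y x₀ h e) (hg : ∀ j, ‖g (e j) (x₀ + h * ξ j)‖ ≤ M)
    (he0 : ‖e 0‖ ≤ r / 2) (i : Fin (p + 1)) : ‖e i‖ ≤ r := by
  have e1 : e i = e 0 + h • ∑ j, intMatrix ξ i j • g (e j) (x₀ + h * ξ j) -
      (y (x₀ + h * ξ i) - y x₀) := by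
    rw [eq_sub_iff_add_eq, ← add_sub_assoc, add_comm (e i), he i]
    abel
  rw [e1]
  have h2 : ‖h • ∑ j, intMatrix ξ i j • g (e j) (x₀ + h * ξ j)‖ ≤ h * (weightBound ξ * M) := by
    rw [norm_smul, Real.norm_of_nonneg h0]
    exact mul_le_mul_of_nonneg_left (norm_sum_intMatrix_smul_le i hM hg) h0
  have h3 := ht.norm_node_sub_le hξ hp hx₀ h0 hb i
  linarith [(norm_sub_le _ _).trans (add_le_add ((norm_add_le _ _).trans
    (add_le_add he0 h2)) h3)]

theorem IsStageError.unique (ht : IsSmoothTube a b r L g y J)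
    (hξ : IsGaussLobatto p ξ) (hp : 1 ≤ p) {x₀ h : ℝ}
    (hx₀ : a ≤ x₀) (h0 : 0 ≤ h) (hb : x₀ + h ≤ b) (hh : h * (weightBound ξ * L) ≤ 1 / 2)
    {e e' : Fin (p + 1) → E} (he : IsStageError ξ g y x₀ h e) (he' : IsStageError ξ g y x₀ h e')
    (her : ∀ i, ‖e i‖ ≤ r) (her' : ∀ i, ‖e' i‖ ≤ r) (h00 : e 0 = e' 0) : e = e' := by
  have hL := ht.const_nonneg
  have hW := one_le_weightBound ξ
  have key : ‖e - e'‖ ≤ h * (weightBound ξ * (L * ‖e - e'‖)) := by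
    refine (pi_norm_le_iff_of_nonneg (by positivity)).2 fun i => ?_
    have e1 : (e - e') i = h • ∑ j, intMatrix ξ i j •
        (g (e j) (x₀ + h * ξ j) - g (e' j) (x₀ + h * ξ j)) := by
      have h1 := he i
      have h2 := he' i
      simp only [smul_sub, Finset.sum_sub_distrib, Pi.sub_apply]
      rw [h00] at h1
      have h3 := congrArg₂ (· - ·) h1 h2
      simp only [add_sub_add_left_eq_sub] at h3
      exact h3
    rw [e1, norm_smul, Real.norm_of_nonneg h0]
    refine mul_le_mul_of_nonneg_left (norm_sum_intMatrix_smul_le i (by positivity) fun j => ?_) h0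
    refine (ht.lipschitz _ (hξ.node_mem hp hx₀ h0 hb j) _ _ (her j) (her' j)).trans ?_
    exact mul_le_mul_of_nonneg_left (norm_le_pi_norm (e - e') j) hL
  have h1 : h * (weightBound ξ * (L * ‖e - e'‖)) ≤ 1 / 2 * ‖e - e'‖ := by
    calc _ = h * (weightBound ξ * L) * ‖e - e'‖ := by ring
      _ ≤ _ := mul_le_mul_of_nonneg_right hh (norm_nonneg _)
  have h2 : ‖e - e'‖ = 0 := le_antisymm (by linarith) (norm_nonneg _)
  exact sub_eq_zero.1 (norm_eq_zero.1 h2)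

theorem IsSmoothTube.exists_isStageError [CompleteSpace E] (ht : IsSmoothTube a b r L g y J)
    (hξ : IsGaussLobatto p ξ) (hp : 1 ≤ p) {x₀ h : ℝ}
    (hx₀ : a ≤ x₀) (h0 : 0 ≤ h) (hb : x₀ + h ≤ b) (hh : h * (weightBound ξ * L) ≤ 1 / 2)
    (hh' : h * (weightBound ξ * L + L) ≤ r / 2) {v : E} (hv : ‖v‖ ≤ r / 2) :
    ∃ e : Fin (p + 1) → E, IsStageError ξ g y x₀ h e ∧ (∀ i, ‖e i‖ ≤ r) ∧ e 0 = v := by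
  have hL := ht.const_nonneg
  have hr := ht.radius_pos.le
  have hW := one_le_weightBound ξ
  have hmem := hξ.node_mem hp hx₀ h0 hb
  -- The entry deviation v is fixed here. Row 0 of the integration matrix vanishes and ξ 0 = 0, so
  -- every fixed point has e 0 = v.
  set Φ : (Fin (p + 1) → E) → (Fin (p + 1) → E) := fun e i =>
    v + h • ∑ j, intMatrix ξ i j • g (e j) (x₀ + h * ξ j) - (y (x₀ + h * ξ i) - y x₀) with hΦ
  set s : Set (Fin (p + 1) → E) := Metric.closedBall 0 r with hs
  have hsmem : ∀ e ∈ s, ∀ i, ‖e i‖ ≤ r := fun e he i =>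
    (norm_le_pi_norm e i).trans (by simpa [hs] using he)
  have hmaps : MapsTo Φ s s := by
    intro e he
    rw [hs, mem_closedBall_zero_iff]
    refine (pi_norm_le_iff_of_nonneg hr).2 fun i => ?_
    have h2 : ‖h • ∑ j, intMatrix ξ i j • g (e j) (x₀ + h * ξ j)‖ ≤ h * (weightBound ξ * L) := by
      rw [norm_smul, Real.norm_of_nonneg h0]
      exact mul_le_mul_of_nonneg_left (norm_sum_intMatrix_smul_le i hL
        fun j => ht.bound _ (hmem j) _ (hsmem e he j)) h0
    have h3 := ht.norm_node_sub_le hξ hp hx₀ h0 hb i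
    linarith [(norm_sub_le _ _).trans (add_le_add ((norm_add_le v
      (h • ∑ j, intMatrix ξ i j • g (e j) (x₀ + h * ξ j))).trans (add_le_add hv h2)) h3)]
  have hcontr : ContractingWith (1 / 2) (hmaps.restrict Φ s s) := by
    refine ⟨by norm_num, LipschitzWith.of_dist_le_mul fun e e' => ?_⟩
    rw [Subtype.dist_eq, Subtype.dist_eq, dist_eq_norm, dist_eq_norm]
    have : ((1 / 2 : NNReal) : ℝ) = 1 / 2 := by norm_num
    rw [this]
    refine (pi_norm_le_iff_of_nonneg (by positivity)).2 fun i => ?_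
    have e1 : (((hmaps.restrict Φ s s e : s) : Fin (p + 1) → E) -
        (hmaps.restrict Φ s s e' : s)) i = h • ∑ j, intMatrix ξ i j •
          (g (e.1 j) (x₀ + h * ξ j) - g (e'.1 j) (x₀ + h * ξ j)) := by
      simp only [smul_sub, Finset.sum_sub_distrib, Pi.sub_apply, MapsTo.val_restrict_apply, hΦ]
      abel
    rw [e1, norm_smul, Real.norm_of_nonneg h0]
    calc _ ≤ h * (weightBound ξ * (L * ‖e.1 - e'.1‖)) := by
          refine mul_le_mul_of_nonneg_left
            (norm_sum_intMatrix_smul_le i (by positivity) fun j => ?_) h0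
          refine (ht.lipschitz _ (hmem j) _ _ (hsmem _ e.2 j) (hsmem _ e'.2 j)).trans ?_
          exact mul_le_mul_of_nonneg_left (norm_le_pi_norm (e.1 - e'.1) j) hL
      _ = h * (weightBound ξ * L) * ‖e.1 - e'.1‖ := by ring
      _ ≤ _ := mul_le_mul_of_nonneg_right hh (norm_nonneg _)
  obtain ⟨e, hes, hfix, -⟩ := ContractingWith.exists_fixedPoint'
    (Metric.isClosed_closedBall.isComplete) hmaps hcontr
    (x := 0) (by simpa [hs] using hr) (edist_ne_top _ _)
  have hfix' : ∀ i, e i = v + h • ∑ j, intMatrix ξ i j • g (e j) (x₀ + h * ξ j) -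
      (y (x₀ + h * ξ i) - y x₀) := fun i => (congrFun hfix i).symm
  have he0 : e 0 = v := by
    rw [hfix' 0]
    simp [hξ.intMatrix_zero hp, hξ.first hp]
  refine ⟨e, fun i => ?_, hsmem e hes, he0⟩
  rw [he0]
  conv_lhs => rw [hfix' i]
  abel

/-- The bound for the error at the point `x` that is propagated along the mesh. -/
noncomputable def errorBound (C a h : ℝ) (n : ℕ) (x : ℝ) : ℝ :=
  C * h ^ n * (x - a) * Real.exp (C * (x - a))

theorem errorBound_le {C h : ℝ} {n : ℕ} (hC : 0 ≤ C) (h0 : 0 ≤ h) {x : ℝ} (hx : x ∈ Icc a b) :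
    errorBound C a h n x ≤ C * (b - a) * Real.exp (C * (b - a)) * h ^ n := by
  have h1 : x - a ≤ b - a := by linarith [hx.2]
  have h2 : 0 ≤ x - a := by linarith [hx.1]
  have h3 : 0 ≤ b - a := h2.trans h1
  calc errorBound C a h n x ≤ C * h ^ n * (b - a) * Real.exp (C * (b - a)) := by
        rw [errorBound]
        gcongr
    _ = _ := by ring

/-- Discrete Gronwall step: 1 + Cw ≤ exp(Cw) carries the old error over, and w^(n+1) ≤ h^n w makes
the local errors add up to a multiple of the length covered, also on nonuniform meshes. -/
theorem errorBound_step {C h w ε : ℝ} {n : ℕ} (hC : 0 ≤ C) (hw : 0 ≤ w) (hwh : w ≤ h)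
    {x : ℝ} (hx : a ≤ x) (hε : ε ≤ errorBound C a h n x) :
    (1 + C * w) * ε + C * w ^ (n + 1) ≤ errorBound C a h n (x + w) := by
  have h0 : 0 ≤ h := hw.trans hwh
  have h1 : 1 + C * w ≤ Real.exp (C * w) := by linarith [Real.add_one_le_exp (C * w)]
  have h2 : 0 ≤ x - a := by linarith
  have h3 : w ^ (n + 1) ≤ h ^ n * w := by
    rw [pow_succ]
    gcongr
  have h4 : 1 ≤ Real.exp (C * (x + w - a)) := Real.one_le_exp (by
    have : 0 ≤ x + w - a := by linarith
    positivity)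
  have h5 : 0 ≤ errorBound C a h n x := by rw [errorBound]; positivity
  have h6 : C * w ^ (n + 1) ≤ C * (h ^ n * w) * Real.exp (C * (x + w - a)) := by
    refine (mul_le_mul_of_nonneg_left h3 hC).trans ?_
    exact le_mul_of_one_le_right (by positivity) h4
  calc (1 + C * w) * ε + C * w ^ (n + 1)
      ≤ Real.exp (C * w) * errorBound C a h n x +
          C * (h ^ n * w) * Real.exp (C * (x + w - a)) := by
        refine add_le_add ?_ h6
        calc (1 + C * w) * ε ≤ (1 + C * w) * errorBound C a h n x := by gcongr
          _ ≤ _ := by gcongr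
    _ = _ := by
        rw [errorBound, errorBound, show C * (x + w - a) = C * (x - a) + C * w by ring,
          Real.exp_add]
        ring

end Element

/-! ### The global error on a mesh -/

section MeshError

variable {E : Type*} [NormedAddCommGroup E] [NormedSpace ℝ E] {a b r L : ℝ} {p : ℕ}
  {ξ : Fin (p + 1) → ℝ} {g : E → ℝ → E} {y : ℝ → E} {J : ℝ → E →L[ℝ] E}

namespace Mesh

theorem width_pos (T : Mesh a b) (K : Fin T.N) : 0 < T.width K :=
  sub_pos.2 (T.strictMono Fin.castSucc_lt_succ)

theorem left_le_vertex (T : Mesh a b) (k : Fin (T.N + 1)) : a ≤ T.vertex k := by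
  conv_lhs => rw [← T.left_eq]
  exact T.strictMono.monotone (Fin.zero_le k)

theorem vertex_le_right (T : Mesh a b) (k : Fin (T.N + 1)) : T.vertex k ≤ b := by
  conv_rhs => rw [← T.right_eq]
  exact T.strictMono.monotone (Fin.le_last k)

theorem vertex_add_width (T : Mesh a b) (K : Fin T.N) :
    T.vertex K.castSucc + T.width K = T.vertex K.succ := by
  rw [width]
  ring

end Mesh

/-- A nodally continuous solution of the stage equations on all elements, without initial error,
in terms of the deviations from the solution `y`. -/
structure IsMeshError (ξ : Fin (p + 1) → ℝ) (g : E → ℝ → E) (y : ℝ → E) (T : Mesh a b)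
    (e : Fin T.N → Fin (p + 1) → E) : Prop where
  stage : ∀ K, IsStageError ξ g y (T.vertex K.castSucc) (T.width K) (e K)
  continuous : ∀ K M : Fin T.N, M.val = K.val + 1 → e M 0 = e K (Fin.last p)
  initial : ∀ K : Fin T.N, K.val = 0 → e K 0 = 0

theorem exists_pos_forall_mul_le (c : Finset ℝ) {η : ℝ} (hη : 0 < η) :
    ∃ h₀ : ℝ, 0 < h₀ ∧ h₀ ≤ 1 ∧ ∀ k ∈ c, ∀ h : ℝ, 0 ≤ h → h ≤ h₀ → h * k ≤ η := by
  set m := ∑ k ∈ c, |k| with hm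
  have hm0 : 0 ≤ m := Finset.sum_nonneg fun k _ => abs_nonneg k
  refine ⟨min 1 (η / (m + 1)), lt_min one_pos (by positivity), min_le_left _ _,
    fun k hk h h0 hh => ?_⟩
  have h1 : |k| ≤ m := Finset.single_le_sum (f := fun k => |k|) (fun k _ => abs_nonneg k) hk
  have h2 : h ≤ η / (m + 1) := hh.trans (min_le_right _ _)
  rw [le_div_iff₀ (by positivity)] at h2
  nlinarith [le_abs_self k]

theorem IsSmoothTube.exists_isMeshError [CompleteSpace E] (hab : a < b) (hp : 1 ≤ p)
    (hξ : IsGaussLobatto p ξ) (ht : IsSmoothTube a b r L g y J) :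
    ∃ h₀ : ℝ, 0 < h₀ ∧ ∀ T : Mesh a b, (∀ K, T.width K ≤ h₀) →
      ∃ e : Fin T.N → Fin (p + 1) → E, IsMeshError ξ g y T e ∧ ∀ K i, ‖e K i‖ ≤ r := by
  obtain ⟨C, hC, hloc⟩ := IsStageError.exists_le hab hp hξ ht
  have hr := ht.radius_pos
  obtain ⟨h₁, hh₁, hh₁', H₁⟩ :=
    exists_pos_forall_mul_le {weightBound ξ * L} (η := 1 / 2) (by norm_num)
  obtain ⟨h₂, hh₂, hh₂', H₂⟩ := exists_pos_forall_mul_le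
    {weightBound ξ * L + L, C * (b - a) * Real.exp (C * (b - a))} (η := r / 2) (by linarith)
  refine ⟨min h₁ h₂, lt_min hh₁ hh₂, fun T hT => ?_⟩
  set h := min h₁ h₂ with hh
  have h0 : 0 ≤ h := (lt_min hh₁ hh₂).le
  have h1 : h ≤ 1 := (min_le_left _ _).trans hh₁'
  have hb : ∀ K : Fin T.N, T.vertex K.castSucc + T.width K ≤ b := fun K => by
    rw [T.vertex_add_width]; exact T.vertex_le_right _
  have hsmall : ∀ k : Fin (T.N + 1), errorBound C a h (2 * p) (T.vertex k) ≤ r / 2 := by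
    intro k
    refine (errorBound_le (b := b) hC h0 ⟨T.left_le_vertex k, T.vertex_le_right k⟩).trans ?_
    have h2 := H₂ (C * (b - a) * Real.exp (C * (b - a))) (by simp) h h0 (min_le_right _ _)
    have h3 : h ^ (2 * p) ≤ h := pow_le_of_le_one h0 h1 (by omega)
    have h4 : 0 ≤ C * (b - a) * Real.exp (C * (b - a)) := by
      have : 0 ≤ b - a := by linarith
      positivity
    calc _ ≤ C * (b - a) * Real.exp (C * (b - a)) * h := by gcongr
      _ ≤ _ := by linarith
  -- The smallness of v is put behind the existential, so that `choose` gives a solver for every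
  -- entry value and the march along the mesh can be defined before its values are known to be
  -- small.
  have hex : ∀ (K : Fin T.N) (v : E), ∃ e : Fin (p + 1) → E, ‖v‖ ≤ r / 2 →
      IsStageError ξ g y (T.vertex K.castSucc) (T.width K) e ∧ (∀ i, ‖e i‖ ≤ r) ∧ e 0 = v := by
    intro K v
    by_cases hv : ‖v‖ ≤ r / 2
    · obtain ⟨e, he⟩ := ht.exists_isStageError hξ hp (T.left_le_vertex _) (T.width_pos K).le (hb K)
        (H₁ _ (by simp) _ (T.width_pos K).le ((hT K).trans (min_le_left _ _)))
        (H₂ _ (by simp) _ (T.width_pos K).le ((hT K).trans (min_le_right _ _))) hv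
      exact ⟨e, fun _ => he⟩
    · exact ⟨0, fun h => absurd h hv⟩
  choose s hs using hex
  -- Entry deviation of element n: the last stage of the preceding element, starting from 0, with
  -- the dummy value 0 past the mesh.
  set v : ℕ → E := fun n => Nat.rec 0
    (fun n vn => if hn : n < T.N then s ⟨n, hn⟩ vn (Fin.last p) else 0) n with hv
  have hvs : ∀ K : Fin T.N, v (K.val + 1) = s K (v K.val) (Fin.last p) := fun K => by
    simp [hv, K.2]
  have hvn : ∀ n (hn : n < T.N + 1), ‖v n‖ ≤ errorBound C a h (2 * p) (T.vertex ⟨n, hn⟩) := by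
    intro n
    induction n with
    | zero =>
      intro hn
      have : T.vertex ⟨0, hn⟩ = a := T.left_eq
      simp only [errorBound, this, sub_self, mul_zero, zero_mul]
      exact norm_zero.le
    | succ n ih =>
      intro hn
      set K : Fin T.N := ⟨n, by omega⟩ with hK
      have ihK : ‖v n‖ ≤ errorBound C a h (2 * p) (T.vertex K.castSucc) := ih (by omega)
      obtain ⟨s1, s2, s3⟩ := hs K (v n) (ihK.trans (hsmall _))
      have := (hloc _ _ (T.left_le_vertex _) (T.width_pos K).le ((hT K).trans h1)
        (H₁ _ (by simp) _ (T.width_pos K).le ((hT K).trans (min_le_left _ _))) (hb K) _ s2 s1).2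
      rw [s3] at this
      have e := errorBound_step hC (T.width_pos K).le (hT K) (T.left_le_vertex K.castSucc) ihK
      rw [T.vertex_add_width] at e
      exact (hvs K).symm ▸ this.trans e
  have hall : ∀ K : Fin T.N, ‖v K.val‖ ≤ r / 2 := fun K =>
    (hvn K.val (by omega)).trans (hsmall _)
  refine ⟨fun K => s K (v K.val), ⟨fun K => (hs K _ (hall K)).1, fun K M hKM => ?_, fun K hK => ?_⟩,
    fun K => (hs K _ (hall K)).2.1⟩
  · rw [(hs M _ (hall M)).2.2, hKM, hvs]
  · rw [(hs K _ (hall K)).2.2, hK]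
    rfl

theorem IsMeshError.exists_le (hab : a < b) (hp : 1 ≤ p)
    (hξ : IsGaussLobatto p ξ) (ht : IsSmoothTube a b r L g y J) (M : ℝ) :
    ∃ C : ℝ, 0 < C ∧ ∃ h₀ : ℝ, 0 < h₀ ∧ ∀ h : ℝ, h ≤ h₀ → ∀ T : Mesh a b,
      (∀ K, T.width K ≤ h) → ∀ e : Fin T.N → Fin (p + 1) → E, IsMeshError ξ g y T e →
        (∀ K i, ‖g (e K i) (T.node ξ K i)‖ ≤ M) →
        (∀ e' : Fin T.N → Fin (p + 1) → E, IsMeshError ξ g y T e' →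
          (∀ K i, ‖g (e' K i) (T.node ξ K i)‖ ≤ M) → e' = e) ∧
        (∀ K, ‖e K 0‖ ≤ C * h ^ (2 * p) ∧ ‖e K (Fin.last p)‖ ≤ C * h ^ (2 * p)) ∧
        ∀ K i, ‖e K i‖ ≤ C * h ^ min (p + 2) (2 * p) := by
  obtain ⟨C, hC, hloc⟩ := IsStageError.exists_le hab hp hξ ht
  have hr := ht.radius_pos
  set C' := C * (b - a) * Real.exp (C * (b - a)) with hC'
  have hC'0 : 0 ≤ C' := by
    have : 0 ≤ b - a := by linarith
    positivity
  obtain ⟨h₁, hh₁, hh₁', H₁⟩ :=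
    exists_pos_forall_mul_le {weightBound ξ * L} (η := 1 / 2) (by norm_num)
  obtain ⟨h₂, hh₂, hh₂', H₂⟩ := exists_pos_forall_mul_le
    {weightBound ξ * max M 0 + L, C'} (η := r / 2) (by linarith)
  refine ⟨C' + C * (C' + 1) + 1, by positivity, min h₁ h₂, lt_min hh₁ hh₂, fun h hh T hT => ?_⟩
  have hb : ∀ K : Fin T.N, T.vertex K.castSucc + T.width K ≤ b := fun K => by
    rw [T.vertex_add_width]; exact T.vertex_le_right _
  -- The number h is not assumed nonnegative; a < b forces an element to exist, and its width bounds
  -- h from below.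
  have hN : 0 < T.N := by
    by_contra hN
    have h1 := T.left_eq
    have h2 := T.right_eq
    have : (0 : Fin (T.N + 1)) = Fin.last T.N := Fin.ext (by simp; omega)
    rw [this, h2] at h1
    linarith
  have h0 : 0 ≤ h := (T.width_pos ⟨0, hN⟩).le.trans (hT _)
  have h1 : h ≤ 1 := hh.trans ((min_le_left _ _).trans hh₁')
  have hsmall : ∀ k : Fin (T.N + 1), errorBound C a h (2 * p) (T.vertex k) ≤ C' * h ^ (2 * p) :=
    fun k => errorBound_le (b := b) hC h0 ⟨T.left_le_vertex k, T.vertex_le_right k⟩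
  have hsmall' : C' * h ^ (2 * p) ≤ r / 2 := by
    have h2 := H₂ C' (by simp) h h0 (hh.trans (min_le_right _ _))
    have h3 : h ^ (2 * p) ≤ h := pow_le_of_le_one h0 h1 (by omega)
    calc _ ≤ C' * h := by gcongr
      _ ≤ _ := by linarith
  have hH₁ : ∀ K, T.width K * (weightBound ξ * L) ≤ 1 / 2 := fun K =>
    H₁ _ (by simp) _ (T.width_pos K).le ((hT K).trans (hh.trans (min_le_left _ _)))
  have main : ∀ e : Fin T.N → Fin (p + 1) → E, IsMeshError ξ g y T e →
      (∀ K i, ‖g (e K i) (T.node ξ K i)‖ ≤ M) → ∀ K : Fin T.N,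
      ‖e K 0‖ ≤ errorBound C a h (2 * p) (T.vertex K.castSucc) ∧
      ‖e K (Fin.last p)‖ ≤ errorBound C a h (2 * p) (T.vertex K.succ) ∧ (∀ i, ‖e K i‖ ≤ r) ∧
      ∀ i, ‖e K i‖ ≤ C * (‖e K 0‖ + T.width K ^ (p + 2)) := by
    intro e he heM
    have step : ∀ K : Fin T.N, ‖e K 0‖ ≤ errorBound C a h (2 * p) (T.vertex K.castSucc) →
        ‖e K 0‖ ≤ errorBound C a h (2 * p) (T.vertex K.castSucc) ∧
        ‖e K (Fin.last p)‖ ≤ errorBound C a h (2 * p) (T.vertex K.succ) ∧ (∀ i, ‖e K i‖ ≤ r) ∧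
        ∀ i, ‖e K i‖ ≤ C * (‖e K 0‖ + T.width K ^ (p + 2)) := by
      intro K hK
      have hrK := (he.stage K).norm_le ht hξ hp (T.left_le_vertex _) (T.width_pos K).le (hb K)
        (le_max_right M 0)
        (H₂ _ (by simp) _ (T.width_pos K).le ((hT K).trans (hh.trans (min_le_right _ _))))
        (fun j => (heM K j).trans (le_max_left _ _)) (hK.trans ((hsmall _).trans hsmall'))
      obtain ⟨l1, l2⟩ := hloc _ _ (T.left_le_vertex _) (T.width_pos K).le ((hT K).trans h1)
        (hH₁ K) (hb K) _ hrK (he.stage K)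
      have es := errorBound_step hC (T.width_pos K).le (hT K) (T.left_le_vertex K.castSucc) hK
      rw [T.vertex_add_width] at es
      exact ⟨hK, l2.trans es, hrK, l1⟩
    have : ∀ n (hn : n < T.N),
        ‖e ⟨n, hn⟩ 0‖ ≤ errorBound C a h (2 * p) (T.vertex (Fin.castSucc ⟨n, hn⟩)) := by
      intro n
      induction n with
      | zero =>
        intro hn
        rw [he.initial _ rfl, norm_zero]
        have : T.vertex (Fin.castSucc ⟨0, hn⟩) = a := T.left_eq
        simp only [errorBound, this, sub_self, mul_zero, zero_mul, le_refl]
      | succ n ih =>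
        intro hn
        rw [he.continuous ⟨n, by omega⟩ ⟨n + 1, hn⟩ rfl]
        exact (step ⟨n, by omega⟩ (ih (by omega))).2.1
    exact fun K => step K (this K.val K.2)
  intro e he heM
  have hP : 0 ≤ h ^ (2 * p) := by positivity
  refine ⟨fun e' he' heM' => ?_, fun K => ?_, fun K i => ?_⟩
  · have : ∀ n (hn : n < T.N), e' ⟨n, hn⟩ = e ⟨n, hn⟩ := by
      intro n
      induction n with
      | zero =>
        intro hn
        refine (he'.stage _).unique ht hξ hp (T.left_le_vertex _) (T.width_pos _).le (hb _)
          (hH₁ _) (he.stage _) (main e' he' heM' _).2.2.1 (main e he heM _).2.2.1 ?_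
        rw [he.initial _ rfl, he'.initial _ rfl]
      | succ n ih =>
        intro hn
        refine (he'.stage _).unique ht hξ hp (T.left_le_vertex _) (T.width_pos _).le (hb _)
          (hH₁ _) (he.stage _) (main e' he' heM' _).2.2.1 (main e he heM _).2.2.1 ?_
        rw [he.continuous ⟨n, by omega⟩ ⟨n + 1, hn⟩ rfl,
          he'.continuous ⟨n, by omega⟩ ⟨n + 1, hn⟩ rfl, ih]
    exact funext fun K => this K.val K.2
  · have hle : C' * h ^ (2 * p) ≤ (C' + C * (C' + 1) + 1) * h ^ (2 * p) := by
      refine mul_le_mul_of_nonneg_right ?_ hP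
      have : 0 ≤ C * (C' + 1) := by positivity
      linarith
    exact ⟨(main e he heM K).1.trans ((hsmall _).trans hle),
      (main e he heM K).2.1.trans ((hsmall _).trans hle)⟩
  · have hw : T.width K ^ (p + 2) ≤ h ^ min (p + 2) (2 * p) :=
      (pow_le_pow_left₀ (T.width_pos K).le (hT K) _).trans
        (pow_le_pow_of_le_one h0 h1 (min_le_left _ _))
    have hq : h ^ (2 * p) ≤ h ^ min (p + 2) (2 * p) :=
      pow_le_pow_of_le_one h0 h1 (min_le_right _ _)
    have hmin : 0 ≤ h ^ min (p + 2) (2 * p) := by positivity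
    calc ‖e K i‖ ≤ C * (‖e K 0‖ + T.width K ^ (p + 2)) := (main e he heM K).2.2.2 i
      _ ≤ C * (C' * h ^ min (p + 2) (2 * p) + h ^ min (p + 2) (2 * p)) := by
          gcongr
          exact (main e he heM K).1.trans ((hsmall _).trans (by gcongr))
      _ = C * (C' + 1) * h ^ min (p + 2) (2 * p) := by ring
      _ ≤ _ := by
          refine mul_le_mul_of_nonneg_right ?_ hmin
          linarith

end MeshError

/-! ### Bounded inverses of the flux linearization -/

section Inverse

variable {m : ℕ}

/-- The determinant is the product of the eigenvalues, so the possibly ill-conditioned eigenvector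
matrix P cancels. -/
theorem IsDiagonalizableAwayFromZero.pow_le_abs_det {c : ℝ} (hc : 0 ≤ c)
    {M : Matrix (Fin m) (Fin m) ℝ} (hM : IsDiagonalizableAwayFromZero c M) :
    c ^ m ≤ |M.det| := by
  obtain ⟨P, ev, hP, h, hev⟩ := hM
  have h1 := congrArg Matrix.det h
  rw [Matrix.det_mul, Matrix.det_mul, mul_comm, Matrix.det_diagonal] at h1
  have h2 := mul_left_cancel₀ hP.ne_zero h1
  have h3 : (M.map fun r : ℝ => (r : ℂ)).det = (M.det : ℂ) :=
    (RingHom.map_det Complex.ofRealHom M).symm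
  rw [h3] at h2
  have h4 : |M.det| = ∏ j, ‖ev j‖ := by
    rw [← norm_prod, ← h2, Complex.norm_real, Real.norm_eq_abs]
  rw [h4]
  calc c ^ m = ∏ _j : Fin m, c := by simp
    _ ≤ _ := Finset.prod_le_prod (fun _ _ => hc) fun j _ => hev j

theorem abs_adjugate_le {R : ℝ} {M : Matrix (Fin m) (Fin m) ℝ} (hM : ∀ i j, |M i j| ≤ R)
    (i j : Fin m) : |M.adjugate i j| ≤ m.factorial * max R 1 ^ m := by
  rw [Matrix.adjugate_apply]
  have := Matrix.det_le (A := M.updateRow j (Pi.single i 1)) (abv := AbsoluteValue.abs)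
    (x := max R 1) (fun k l => ?_)
  · simpa using this
  · by_cases hk : k = j
    · subst hk
      by_cases hl : l = i
      · subst hl; simp
      · simp [hl]
    · simpa [hk] using Or.inl (hM k l)

/-- From det(M) v = adj(M) M v: the inverse is controlled by the entries and the determinant alone,
uniformly in M. -/
theorem exists_norm_le_mulVec {c : ℝ} (hc : 0 < c) (R : ℝ) :
    ∃ κ : ℝ, 0 ≤ κ ∧ ∀ M : Matrix (Fin m) (Fin m) ℝ, (∀ i j, |M i j| ≤ R) →
      IsDiagonalizableAwayFromZero c M → ∀ v, ‖v‖ ≤ κ * ‖M.mulVec v‖ := by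
  refine ⟨m * (m.factorial * max R 1 ^ m) / c ^ m, by positivity, fun M hM hdiag v => ?_⟩
  have hdet := hdiag.pow_le_abs_det hc.le
  have hcm : 0 < c ^ m := by positivity
  have hB : 0 ≤ (m.factorial : ℝ) * max R 1 ^ m := by positivity
  rw [div_mul_eq_mul_div, le_div_iff₀ hcm]
  have key : M.det • v = M.adjugate.mulVec (M.mulVec v) := by
    rw [Matrix.mulVec_mulVec, Matrix.adjugate_mul, Matrix.smul_mulVec, Matrix.one_mulVec]
  have h1 : ‖M.adjugate.mulVec (M.mulVec v)‖ ≤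
      m * (m.factorial * max R 1 ^ m) * ‖M.mulVec v‖ := by
    refine (pi_norm_le_iff_of_nonneg (by positivity)).2 fun i => ?_
    rw [Matrix.mulVec, dotProduct]
    refine (norm_sum_le_of_le _ (f := fun j => M.adjugate i j * M.mulVec v j)
      (n := fun _ => m.factorial * max R 1 ^ m * ‖M.mulVec v‖) fun j _ => ?_).trans_eq ?_
    · rw [norm_mul]
      exact mul_le_mul (abs_adjugate_le hM i j) (norm_le_pi_norm _ j) (norm_nonneg _) hB
    · simp
      ring
  rw [← key, norm_smul, Real.norm_eq_abs] at h1
  calc ‖v‖ * c ^ m ≤ |M.det| * ‖v‖ := by rw [mul_comm]; gcongr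
    _ ≤ _ := h1

theorem IsFluxLinearization.exists_norm_sub_le {Ω : Set (Fin m → ℝ)}
    {F : (Fin m → ℝ) → (Fin m → ℝ)}
    {A : (Fin m → ℝ) → (Fin m → ℝ) → Matrix (Fin m) (Fin m) ℝ} {c : ℝ} (hc : 0 < c)
    (hA : IsFluxLinearization Ω F A c) :
    ∃ κ : ℝ, 0 ≤ κ ∧ ∀ u ∈ Ω, ∀ v ∈ Ω, ‖u - v‖ ≤ κ * ‖F u - F v‖ := by
  obtain ⟨R, hR⟩ := hA.bounded
  obtain ⟨κ, hκ, h⟩ := exists_norm_le_mulVec (m := m) hc R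
  refine ⟨κ, hκ, fun u hu v hv => ?_⟩
  rw [hA.linearization u hu v hv]
  exact h _ (hR u hu v hv) (hA.eigenvalues u hu v hv) _

end Inverse

section LocalInverse

variable {E : Type*} [NormedAddCommGroup E] [NormedSpace ℝ E]

/-- A map with a Lipschitz inverse has an injective derivative. -/
theorem injective_of_hasFDerivAt_of_norm_sub_le {Ω : Set E} {F : E → E} {F' : E →L[ℝ] E} {u : E}
    (hΩ : Ω ∈ nhds u) {κ : ℝ} (hκ : 0 ≤ κ) (h : ∀ v ∈ Ω, ‖v - u‖ ≤ κ * ‖F v - F u‖)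
    (hF : HasFDerivAt F F' u) : Function.Injective F' := by
  rw [injective_iff_map_eq_zero]
  intro w hw
  by_contra hw0
  -- If F' w = 0, then F(u + t w) - F(u) = o(t). With this slope the Lipschitz inverse would give ‖t
  -- w‖ ≤ ‖t w‖ / 2.
  have hc : (0 : ℝ) < 1 / (2 * (κ + 1)) := by positivity
  have h1 := (hF.isLittleO.def hc).and hΩ
  have hlim : Filter.Tendsto (fun t : ℝ => u + t • w) (nhdsWithin 0 {0}ᶜ) (nhds u) := by
    have : Filter.Tendsto (fun t : ℝ => u + t • w) (nhds 0) (nhds (u + (0 : ℝ) • w)) :=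
      Continuous.tendsto (by fun_prop) 0
    rw [zero_smul, add_zero] at this
    exact this.mono_left nhdsWithin_le_nhds
  obtain ⟨t, ⟨ht1, ht2⟩, ht0⟩ := ((hlim.eventually h1).and self_mem_nhdsWithin).exists
  have ht0 : t ≠ 0 := ht0
  have e1 : u + t • w - u = t • w := by abel
  rw [e1, map_smul, hw, smul_zero, sub_zero] at ht1
  have h2 := h _ ht2
  rw [e1] at h2
  have hpos : 0 < ‖t • w‖ := norm_pos_iff.2 (smul_ne_zero ht0 hw0)
  have h3 : ‖t • w‖ ≤ κ * (1 / (2 * (κ + 1)) * ‖t • w‖) :=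
    h2.trans (mul_le_mul_of_nonneg_left ht1 hκ)
  have h4 : κ * (1 / (2 * (κ + 1))) ≤ 1 / 2 := by
    rw [mul_one_div, div_le_div_iff₀ (by positivity) (by norm_num)]
    linarith
  nlinarith

variable [FiniteDimensional ℝ E]

/-- The inverse of a smooth map on an open set that has a Lipschitz inverse is smooth, and its
domain is open. -/
theorem isOpen_image_and_contDiffOn_invFunOn {Ω : Set E} (hΩ : IsOpen Ω)
    {F : E → E} (hF : ContDiffOn ℝ ∞ F Ω) (hinj : InjOn F Ω) {κ : ℝ} (hκ : 0 ≤ κ)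
    (h : ∀ u ∈ Ω, ∀ v ∈ Ω, ‖u - v‖ ≤ κ * ‖F u - F v‖) :
    IsOpen (F '' Ω) ∧ ContDiffOn ℝ ∞ (Function.invFunOn F Ω) (F '' Ω) := by
  have : CompleteSpace E := FiniteDimensional.complete ℝ E
  have hequiv : ∀ u ∈ Ω, ∃ F' : E ≃L[ℝ] E, HasFDerivAt F (F' : E →L[ℝ] E) u := by
    intro u hu
    have hd : HasFDerivAt F (fderiv ℝ F u) u :=
      ((hF.contDiffAt (hΩ.mem_nhds hu)).differentiableAt (by simp)).hasFDerivAt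
    have hi := injective_of_hasFDerivAt_of_norm_sub_le (hΩ.mem_nhds hu) hκ
      (fun v hv => h v hv u hu) hd
    refine ⟨(LinearEquiv.ofInjectiveEndo (fderiv ℝ F u : E →ₗ[ℝ] E) hi).toContinuousLinearEquiv,
      hd.congr_fderiv ?_⟩
    ext v
    rfl
  constructor
  · rw [isOpen_iff_mem_nhds]
    rintro _ ⟨u, hu, rfl⟩
    obtain ⟨F', hF'⟩ := hequiv u hu
    have hs := (hF.contDiffAt (hΩ.mem_nhds hu)).hasStrictFDerivAt' hF' (by simp)
    rw [← hs.map_nhds_eq_of_equiv]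
    exact Filter.image_mem_map (hΩ.mem_nhds hu)
  · rintro _ ⟨u, hu, rfl⟩
    obtain ⟨F', hF'⟩ := hequiv u hu
    have hc := hF.contDiffAt (hΩ.mem_nhds hu)
    have hs := hc.hasStrictFDerivAt' hF' (by simp)
    refine ContDiffAt.contDiffWithinAt ?_
    refine (hc.to_localInverse hF' (by simp)).congr_of_eventuallyEq ?_
    -- Near F u the local inverse takes values in Ω, where injectivity of F identifies it with the
    -- global inverse.
    have h1 := hs.eventually_right_inverse
    have h2 : ∀ᶠ v in nhds (F u), hs.localInverse F F' u v ∈ Ω := by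
      have := hs.localInverse_continuousAt
      refine this.eventually (p := fun v => v ∈ Ω) ?_
      rw [hs.localInverse_apply_image]
      exact hΩ.mem_nhds hu
    filter_upwards [h1, h2] with v hv1 hv2
    have hv : v ∈ F '' Ω := ⟨_, hv2, hv1⟩
    exact hinj (Function.invFunOn_mem hv) hv2 ((Function.invFunOn_eq hv).trans hv1.symm)

end LocalInverse

/-! ### Tubes around smooth solutions -/

section Tube

theorem exists_norm_sub_le_of_contDiffOn {X Y : Type*} [NormedAddCommGroup X] [NormedSpace ℝ X]
    [NormedAddCommGroup Y] [NormedSpace ℝ Y] {P : Set X} (hPc : IsCompact P) (hP : Convex ℝ P)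
    (hPu : UniqueDiffOn ℝ P) {f : X → Y} (hf : ContDiffOn ℝ ∞ f P) :
    ∃ M : ℝ, ∀ q ∈ P, ∀ q' ∈ P, ‖f q' - f q‖ ≤ M * ‖q' - q‖ := by
  obtain ⟨M, hM⟩ := hPc.exists_bound_of_continuousOn (hf.continuousOn_fderivWithin hPu (by simp))
  exact ⟨M, fun q hq q' hq' => hP.norm_image_sub_le_of_norm_hasFDerivWithin_le
    (fun x hx => (hf.differentiableOn (by simp) x hx).hasFDerivWithinAt) hM hq hq'⟩

variable {E : Type*} [NormedAddCommGroup E] [NormedSpace ℝ E] [FiniteDimensional ℝ E] {a b r : ℝ}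

/-- All constants come from compactness and convexity of the closed tube. The quadratic bound is the
mean value inequality for G minus its linear part, with x frozen, since the derivative of G is
Lipschitz. -/
theorem exists_isSmoothTube (hab : a < b) (hr : 0 < r) {g : E → ℝ → E}
    (hg : ContDiffOn ℝ ∞ (fun q : E × ℝ => g q.1 q.2) (Metric.closedBall 0 r ×ˢ Icc a b))
    {y : ℝ → E} (hy : ∀ x ∈ Icc a b, HasDerivWithinAt y (g 0 x) (Icc a b) x) :
    ∃ (L : ℝ) (J : ℝ → E →L[ℝ] E), IsSmoothTube a b r L g y J := by
  have : ProperSpace E := FiniteDimensional.proper ℝ E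
  set P : Set (E × ℝ) := Metric.closedBall 0 r ×ˢ Icc a b with hP
  set G : E × ℝ → E := fun q => g q.1 q.2 with hG
  have hPc : IsCompact P := (isCompact_closedBall 0 r).prod isCompact_Icc
  have hPconv : Convex ℝ P := (convex_closedBall 0 r).prod (convex_Icc a b)
  have hPu : UniqueDiffOn ℝ P := by
    refine UniqueDiffOn.prod (uniqueDiffOn_convex (convex_closedBall 0 r) ?_) (uniqueDiffOn_Icc hab)
    exact ⟨0, interior_mono Metric.ball_subset_closedBall
      (by rw [Metric.isOpen_ball.interior_eq]; exact Metric.mem_ball_self hr)⟩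
  have hG' : ContDiffOn ℝ ∞ (fderivWithin ℝ G P) P := hg.fderivWithin hPu (by simp)
  obtain ⟨M₀, hM₀⟩ := hPc.exists_bound_of_continuousOn hg.continuousOn
  obtain ⟨M₁, hM₁⟩ := exists_norm_sub_le_of_contDiffOn hPc hPconv hPu hg
  obtain ⟨M₂, hM₂⟩ := exists_norm_sub_le_of_contDiffOn hPc hPconv hPu hG'
  set L := max (max M₀ M₁) (max M₂ 0) with hL
  have hL0 : M₀ ≤ L := (le_max_left _ _).trans (le_max_left _ _)
  have hL1 : M₁ ≤ L := (le_max_right _ _).trans (le_max_left _ _)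
  have hL2 : M₂ ≤ L := (le_max_left _ _).trans (le_max_right _ _)
  have hL3 : 0 ≤ L := (le_max_right _ _).trans (le_max_right _ _)
  have hmem : ∀ x ∈ Icc a b, ∀ w : E, ‖w‖ ≤ r → (w, x) ∈ P := fun x hx w hw =>
    ⟨by simpa using hw, hx⟩
  have hmem0 : ∀ x ∈ Icc a b, ((0 : E), x) ∈ P := fun x hx => hmem x hx 0 (by simpa using hr.le)
  have hpair : ContDiffOn ℝ ∞ (fun x : ℝ => ((0 : E), x)) (Icc a b) :=
    (contDiff_const.prodMk contDiff_id).contDiffOn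
  have hderiv : ∀ q ∈ P, HasFDerivWithinAt G (fderivWithin ℝ G P q) P q := fun q hq =>
    (hg.differentiableOn (by simp) q hq).hasFDerivWithinAt
  refine ⟨L, fun x => (fderivWithin ℝ G P (0, x)).comp (ContinuousLinearMap.inl ℝ E ℝ), ?_⟩
  refine ⟨hr, hL3, hy, hg.comp hpair hmem0, ?_, fun x hx w hw => (hM₀ _ (hmem x hx w hw)).trans hL0,
    fun x hx w w' hw hw' => ?_, fun x hx w hw => ?_⟩
  · exact (hG'.comp hpair hmem0).clm_comp contDiffOn_const
  · have := (hM₁ _ (hmem x hx w' hw') _ (hmem x hx w hw)).trans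
      (mul_le_mul_of_nonneg_right hL1 (norm_nonneg _))
    simpa [hG, Prod.norm_def] using this
  · set s : Set (E × ℝ) := Metric.closedBall 0 ‖w‖ ×ˢ {x} with hs
    have hsP : s ⊆ P := prod_mono (Metric.closedBall_subset_closedBall hw) (by simpa using hx)
    have hsconv : Convex ℝ s := (convex_closedBall 0 _).prod (convex_singleton x)
    have hH : ∀ q ∈ s, HasFDerivWithinAt (fun q => G q - fderivWithin ℝ G P (0, x) q)
        (fderivWithin ℝ G P q - fderivWithin ℝ G P (0, x)) s q := fun q hq =>
      ((hderiv q (hsP hq)).mono hsP).sub (ContinuousLinearMap.hasFDerivWithinAt _)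
    have hbd : ∀ q ∈ s, ‖fderivWithin ℝ G P q - fderivWithin ℝ G P (0, x)‖ ≤ L * ‖w‖ := by
      rintro ⟨v, t⟩ ⟨hv, ht⟩
      obtain rfl : t = x := ht
      have hv : ‖v‖ ≤ ‖w‖ := by simpa using hv
      refine (hM₂ _ (hmem0 t hx) _ (hmem t hx v (hv.trans hw))).trans ?_
      refine mul_le_mul hL2 ?_ (norm_nonneg _) hL3
      simpa [Prod.norm_def] using hv
    have := hsconv.norm_image_sub_le_of_norm_hasFDerivWithin_le hH hbd
      (x := (0, x)) (y := (w, x)) (by simp [hs]) (by simp [hs])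
    have e1 : ‖(w, x) - ((0 : E), x)‖ = ‖w‖ := by simp [Prod.norm_def]
    have e2 : G (w, x) - fderivWithin ℝ G P (0, x) (w, x) -
        (G (0, x) - fderivWithin ℝ G P (0, x) (0, x)) =
        g w x - g 0 x - ((fderivWithin ℝ G P (0, x)).comp (ContinuousLinearMap.inl ℝ E ℝ)) w := by
      have : (fderivWithin ℝ G P (0, x)) (w, x) - (fderivWithin ℝ G P (0, x)) (0, x) =
          ((fderivWithin ℝ G P (0, x)).comp (ContinuousLinearMap.inl ℝ E ℝ)) w := by
        rw [← map_sub]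
        simp
      rw [← this]
      simp only [hG]
      abel
    rw [e1, e2] at this
    refine this.trans_eq (by ring)

end Tube

/-! ### Discrete steady states and collocation -/

section SteadyState

variable {a b : ℝ} {m p : ℕ} {D : Type*} {Ω : Set (Fin m → ℝ)}
  {F : (Fin m → ℝ) → (Fin m → ℝ)} {S : (Fin m → ℝ) → D → (Fin m → ℝ)} {φ : ℝ → D}
  {α 𝒟 : (Fin m → ℝ) → (Fin m → ℝ) → Matrix (Fin m) (Fin m) ℝ} {ξ : Fin (p + 1) → ℝ}

theorem numFlux_self (u : Fin m → ℝ) : numFlux F α 𝒟 u u = F u := by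
  rw [numFlux, sub_self, Matrix.mulVec_zero, add_zero, ← Matrix.add_mulVec,
    add_sub_cancel, Matrix.one_mulVec]

theorem leftNeighbour_eq {N : ℕ} {U : Fin N → Fin (p + 1) → (Fin m → ℝ)}
    (hU : ∀ K L : Fin N, L.val = K.val + 1 → U L 0 = U K (Fin.last p)) (K : Fin N) :
    leftNeighbour U K = U K 0 := by
  rw [leftNeighbour]
  split_ifs with h
  · exact (hU ⟨K.val - 1, by omega⟩ K (by simp only; omega)).symm
  · rfl

theorem rightNeighbour_eq {N : ℕ} {U : Fin N → Fin (p + 1) → (Fin m → ℝ)}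
    (hU : ∀ K L : Fin N, L.val = K.val + 1 → U L 0 = U K (Fin.last p)) (K : Fin N) :
    rightNeighbour U K = U K (Fin.last p) := by
  rw [rightNeighbour]
  split_ifs with h
  · exact hU K ⟨K.val + 1, h⟩ rfl
  · rfl

theorem dgResidual_eq {T : Mesh a b} {U : Fin T.N → Fin (p + 1) → (Fin m → ℝ)}
    (hU : ∀ K L : Fin T.N, L.val = K.val + 1 → U L 0 = U K (Fin.last p)) (K : Fin T.N)
    (i : Fin (p + 1)) :
    dgResidual F S φ α 𝒟 ξ T U K i = ∑ j, diffMatrix ξ i j •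
      (F (U K j) - T.width K • ∑ k, intMatrix ξ j k • S (U K k) (φ (T.node ξ K k))) := by
  rw [dgResidual, leftNeighbour_eq hU, rightNeighbour_eq hU, numFlux_self, numFlux_self]
  simp only [sub_self, ite_self, smul_zero, add_zero, smul_sub, Finset.sum_sub_distrib]
  congr 1
  simp only [Finset.smul_sum, smul_smul, Matrix.mul_apply]
  rw [Finset.sum_comm]
  refine Finset.sum_congr rfl fun k _ => ?_
  rw [← Finset.sum_smul, Finset.mul_sum]
  congr 1
  exact Finset.sum_congr rfl fun j _ => by ring

/-- For nodally continuous states the equations of the scheme on an element are the stage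
equations of the collocation method. -/
theorem forall_dgResidual_eq_zero_iff (hp : 1 ≤ p) (hξ : IsGaussLobatto p ξ) {T : Mesh a b}
    {U : Fin T.N → Fin (p + 1) → (Fin m → ℝ)}
    (hU : ∀ K L : Fin T.N, L.val = K.val + 1 → U L 0 = U K (Fin.last p)) (K : Fin T.N) :
    (∀ i, dgResidual F S φ α 𝒟 ξ T U K i = 0) ↔
      ∀ i, F (U K i) = F (U K 0) +
        T.width K • ∑ k, intMatrix ξ i k • S (U K k) (φ (T.node ξ K k)) := by
  simp only [dgResidual_eq hU]
  set v : Fin (p + 1) → (Fin m → ℝ) := fun j => F (U K j) -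
    T.width K • ∑ k, intMatrix ξ j k • S (U K k) (φ (T.node ξ K k)) with hv
  -- Row 0 of the integration matrix is zero, so the constant in the kernel of the differentiation
  -- matrix is the flux at the left node.
  have hv0 : v 0 = F (U K 0) := by simp [hv, hξ.intMatrix_zero hp]
  have e : (∀ i, F (U K i) = F (U K 0) +
      T.width K • ∑ k, intMatrix ξ i k • S (U K k) (φ (T.node ξ K k))) ↔ ∀ i, v i = v 0 := by
    refine forall_congr' fun i => ?_
    rw [hv0, hv, sub_eq_iff_eq_add]
  rw [e]
  constructor
  · intro h i
    funext l
    refine eq_of_sum_diffMatrix_mul_eq_zero hξ.1.injective (v := fun j => v j l) (fun i => ?_) i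
    have := congrFun (h i) l
    simpa [hv] using this
  · intro h i
    calc ∑ j, diffMatrix ξ i j • v j = ∑ j, diffMatrix ξ i j • v 0 :=
          Finset.sum_congr rfl fun j _ => by rw [h j]
      _ = 0 := by rw [← Finset.sum_smul, sum_diffMatrix hξ.1.injective, zero_smul]

theorem Mesh.node_zero (hp : 1 ≤ p) (hξ : IsGaussLobatto p ξ) (T : Mesh a b) (K : Fin T.N) :
    T.node ξ K 0 = T.vertex K.castSucc := by
  rw [Mesh.node, hξ.first hp, mul_zero, add_zero]

theorem Mesh.node_last (hp : 1 ≤ p) (hξ : IsGaussLobatto p ξ) (T : Mesh a b) (K : Fin T.N) :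
    T.node ξ K (Fin.last p) = T.vertex K.succ := by
  rw [Mesh.node, hξ.last hp, mul_one, T.vertex_add_width]

theorem Mesh.node_mem (hp : 1 ≤ p) (hξ : IsGaussLobatto p ξ) (T : Mesh a b) (K : Fin T.N)
    (i : Fin (p + 1)) : T.node ξ K i ∈ Icc a b :=
  hξ.node_mem hp (T.left_le_vertex _) (T.width_pos K).le
    (by rw [T.vertex_add_width]; exact T.vertex_le_right _) i

theorem Mesh.succ_eq_castSucc {T : Mesh a b} {K M : Fin T.N} (h : M.val = K.val + 1) :
    T.vertex M.castSucc = T.vertex K.succ :=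
  congrArg T.vertex (Fin.ext (by simpa using h))

variable {y : ℝ → (Fin m → ℝ)} {g : (Fin m → ℝ) → ℝ → (Fin m → ℝ)}

/-- Discrete steady states are the nodally continuous solutions of the stage equations, in
terms of the deviations of the nodal fluxes from `y`. -/
theorem isDiscreteSteadyState_iff (hp : 1 ≤ p) (hξ : IsGaussLobatto p ξ) (hinj : InjOn F Ω)
    {T : Mesh a b} {U : Fin T.N → Fin (p + 1) → (Fin m → ℝ)} (hUΩ : ∀ K i, U K i ∈ Ω)
    (hg : ∀ K i, g (F (U K i) - y (T.node ξ K i)) (T.node ξ K i) =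
      S (U K i) (φ (T.node ξ K i))) :
    IsDiscreteSteadyState Ω F S φ α 𝒟 ξ (y a) T U ↔
      IsMeshError ξ g y T fun K i => F (U K i) - y (T.node ξ K i) := by
  have hstage : ∀ K, IsStageError ξ g y (T.vertex K.castSucc) (T.width K)
      (fun i => F (U K i) - y (T.node ξ K i)) ↔ ∀ i, F (U K i) = F (U K 0) +
        T.width K • ∑ k, intMatrix ξ i k • S (U K k) (φ (T.node ξ K k)) := by
    intro K
    refine forall_congr' fun i => ?_
    have h1 : ∀ j, T.vertex K.castSucc + T.width K * ξ j = T.node ξ K j := fun j => rfl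
    simp only [h1, hg, Mesh.node_zero hp hξ, add_sub_cancel]
  have hcont : ∀ K L : Fin T.N, L.val = K.val + 1 → (U L 0 = U K (Fin.last p) ↔
      F (U L 0) - y (T.node ξ L 0) = F (U K (Fin.last p)) - y (T.node ξ K (Fin.last p))) := by
    intro K L h
    rw [Mesh.node_zero hp hξ, Mesh.node_last hp hξ, Mesh.succ_eq_castSucc h, sub_left_inj]
    exact ⟨fun h => by rw [h], fun h => hinj (hUΩ _ _) (hUΩ _ _) h⟩
  have hinit : ∀ K : Fin T.N, K.val = 0 →
      (F (U K 0) = y a ↔ F (U K 0) - y (T.node ξ K 0) = 0) := by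
    intro K hK
    have : K.castSucc = 0 := Fin.ext (by simpa using hK)
    rw [Mesh.node_zero hp hξ, this, T.left_eq, sub_eq_zero]
  constructor
  · intro h
    have hc := h.nodally_continuous
    exact ⟨fun K => (hstage K).2 ((forall_dgResidual_eq_zero_iff hp hξ hc K).1 (h.steady K)),
      fun K L hKL => (hcont K L hKL).1 (hc K L hKL), fun K hK => (hinit K hK).1 (h.initial K hK)⟩
  · intro h
    have hc : ∀ K L : Fin T.N, L.val = K.val + 1 → U L 0 = U K (Fin.last p) :=
      fun K L hKL => (hcont K L hKL).2 (h.continuous K L hKL)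
    exact ⟨hUΩ, fun K => (forall_dgResidual_eq_zero_iff hp hξ hc K).2 ((hstage K).1 (h.stage K)),
      hc, fun K hK => (hinit K hK).2 (h.initial K hK)⟩

end SteadyState

theorem corollary4 {m p : ℕ} (hp : 1 ≤ p) {D : Type*} {a b : ℝ} (hab : a < b)
    -- the balance law: admissible states, flux, source and data
    (Ω : Set (Fin m → ℝ)) (hΩ : IsOpen Ω)
    (F : (Fin m → ℝ) → (Fin m → ℝ)) (hF : ContDiffOn ℝ ∞ F Ω)
    (S : (Fin m → ℝ) → D → (Fin m → ℝ)) (φ : ℝ → D)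
    (hS : ContDiffOn ℝ ∞ (fun q : (Fin m → ℝ) × ℝ => S q.1 (φ q.2)) (Ω ×ˢ Icc a b))
    -- invertibility of the flux, and its linearization
    (hinv : HasBoundedInverse Ω F)
    (A : (Fin m → ℝ) → (Fin m → ℝ) → Matrix (Fin m) (Fin m) ℝ)
    (C_A : ℝ) (hC_A : 0 < C_A) (hA : IsFluxLinearization Ω F A C_A)
    -- the scheme: Gauss-Lobatto points and numerical flux
    (ξ : Fin (p + 1) → ℝ) (hξ : IsGaussLobatto p ξ)
    (α 𝒟 : (Fin m → ℝ) → (Fin m → ℝ) → Matrix (Fin m) (Fin m) ℝ)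
    -- the exact steady solution
    (Ue : ℝ → (Fin m → ℝ)) (hUe : IsSmoothSteadySolution a b Ω F S φ Ue) :
    -- on fine meshes the discrete steady state exists, in a compact set that is fixed
    (∃ Q : Set (Fin m → ℝ), IsCompact Q ∧ Q ⊆ Ω ∧ ∃ h₀ : ℝ, 0 < h₀ ∧
      ∀ T : Mesh a b, (∀ K, T.width K ≤ h₀) →
        ∃ U : Fin T.N → Fin (p + 1) → (Fin m → ℝ),
          IsDiscreteSteadyState Ω F S φ α 𝒟 ξ (F (Ue a)) T U ∧ ∀ K i, U K i ∈ Q) ∧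
    -- among the states with bounded source it is unique and superconvergent
    (∀ B : Set (Fin m → ℝ), B ⊆ Ω →
      (∃ M : ℝ, ∀ u ∈ B, ∀ x ∈ Icc a b, ‖S u (φ x)‖ ≤ M) →
      ∃ C : ℝ, 0 < C ∧ ∃ h₀ : ℝ, 0 < h₀ ∧
        ∀ h : ℝ, h ≤ h₀ → ∀ T : Mesh a b, (∀ K, T.width K ≤ h) →
          ∀ U : Fin T.N → Fin (p + 1) → (Fin m → ℝ),
            IsDiscreteSteadyState Ω F S φ α 𝒟 ξ (F (Ue a)) T U → (∀ K i, U K i ∈ B) →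
            (∀ V : Fin T.N → Fin (p + 1) → (Fin m → ℝ),
              IsDiscreteSteadyState Ω F S φ α 𝒟 ξ (F (Ue a)) T V → (∀ K i, V K i ∈ B) →
                V = U) ∧
            (∀ K, ‖U K 0 - Ue (T.vertex K.castSucc)‖ ≤ C * h ^ (2 * p) ∧
              ‖U K (Fin.last p) - Ue (T.vertex K.succ)‖ ≤ C * h ^ (2 * p)) ∧
            (∀ K i, ‖U K i - Ue (T.node ξ K i)‖ ≤ C * h ^ min (p + 2) (2 * p))) := by
  obtain ⟨κ, hκ, hlip⟩ := hA.exists_norm_sub_le hC_A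
  have hinj := hinv.1
  obtain ⟨hopen, hsmooth⟩ := isOpen_image_and_contDiffOn_invFunOn hΩ hF hinj hκ hlip
  set R := Function.invFunOn F Ω with hR
  have hRF : ∀ u ∈ Ω, R (F u) = u := fun u hu =>
    hinj (Function.invFunOn_mem ⟨u, hu, rfl⟩) hu (Function.invFunOn_eq ⟨u, hu, rfl⟩)
  have hFR : ∀ v ∈ F '' Ω, R v ∈ Ω ∧ F (R v) = v := fun v hv =>
    ⟨Function.invFunOn_mem hv, Function.invFunOn_eq hv⟩
  set y : ℝ → (Fin m → ℝ) := fun x => F (Ue x) with hy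
  have hysmooth : ContDiffOn ℝ ∞ y (Icc a b) := hF.comp hUe.smooth hUe.admissible
  have hyc : IsCompact (y '' Icc a b) := isCompact_Icc.image_of_continuousOn hysmooth.continuousOn
  obtain ⟨r, hr, hrsub⟩ := hyc.exists_cthickening_subset_open hopen
    (by rintro _ ⟨x, hx, rfl⟩; exact ⟨Ue x, hUe.admissible x hx, rfl⟩)
  have htube : ∀ x ∈ Icc a b, ∀ w : Fin m → ℝ, ‖w‖ ≤ r →
      y x + w ∈ Metric.cthickening r (y '' Icc a b) := fun x hx w hw =>
    Metric.mem_cthickening_of_dist_le _ (y x) _ _ ⟨x, hx, rfl⟩ (by simpa [dist_eq_norm] using hw)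
  -- The source as a function of the flux deviation w from y x. At w = 0 it is S(Ue x; φ x), so the
  -- balance law says that y solves the associated equation.
  set g : (Fin m → ℝ) → ℝ → (Fin m → ℝ) := fun w x => S (R (y x + w)) (φ x) with hg
  have hgsmooth : ContDiffOn ℝ ∞ (fun q : (Fin m → ℝ) × ℝ => g q.1 q.2)
      (Metric.closedBall 0 r ×ˢ Icc a b) := by
    have hin : ∀ q ∈ Metric.closedBall (0 : Fin m → ℝ) r ×ˢ Icc a b, y q.2 + q.1 ∈ F '' Ω :=
      fun q hq => hrsub (htube q.2 hq.2 q.1 (by simpa using hq.1))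
    have h1 : ContDiffOn ℝ ∞ (fun q : (Fin m → ℝ) × ℝ => y q.2 + q.1)
        (Metric.closedBall 0 r ×ˢ Icc a b) :=
      (hysmooth.comp contDiff_snd.contDiffOn fun q hq => hq.2).add contDiff_fst.contDiffOn
    exact hS.comp ((hsmooth.comp h1 hin).prodMk contDiff_snd.contDiffOn)
      fun q hq => ⟨(hFR _ (hin q hq)).1, hq.2⟩
  have hode : ∀ x ∈ Icc a b, HasDerivWithinAt y (g 0 x) (Icc a b) x := by
    intro x hx
    have : g 0 x = S (Ue x) (φ x) := by
      simp only [hg, add_zero, hy]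
      rw [hRF _ (hUe.admissible x hx)]
    rw [this]
    exact hUe.ode x hx
  obtain ⟨L, J, ht⟩ := exists_isSmoothTube hab hr hgsmooth hode
  have hgS : ∀ (T : Mesh a b) (U : Fin T.N → Fin (p + 1) → (Fin m → ℝ)), (∀ K i, U K i ∈ Ω) →
      ∀ K i, g (F (U K i) - y (T.node ξ K i)) (T.node ξ K i) =
        S (U K i) (φ (T.node ξ K i)) := by
    intro T U hU K i
    simp only [hg, add_sub_cancel]
    rw [hRF _ (hU K i)]
  -- The compact set is the preimage of the closed flux tube, which depends on the exact solution
  -- but not on the mesh.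
  refine ⟨⟨R '' Metric.cthickening r (y '' Icc a b), ?_, ?_, ?_⟩, fun B hB ⟨M, hM⟩ => ?_⟩
  · exact hyc.cthickening.image_of_continuousOn (hsmooth.continuousOn.mono hrsub)
  · rintro _ ⟨v, hv, rfl⟩
    exact (hFR v (hrsub hv)).1
  · obtain ⟨h₀, hh₀, H⟩ := ht.exists_isMeshError hab hp hξ
    refine ⟨h₀, hh₀, fun T hT => ?_⟩
    obtain ⟨e, he, her⟩ := H T hT
    have hmem : ∀ K i, y (T.node ξ K i) + e K i ∈ Metric.cthickening r (y '' Icc a b) :=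
      fun K i => htube _ (T.node_mem hp hξ K i) _ (her K i)
    set U : Fin T.N → Fin (p + 1) → (Fin m → ℝ) := fun K i => R (y (T.node ξ K i) + e K i) with hU
    have hUΩ : ∀ K i, U K i ∈ Ω := fun K i => (hFR _ (hrsub (hmem K i))).1
    refine ⟨U, ?_, fun K i => ⟨_, hmem K i, rfl⟩⟩
    refine (isDiscreteSteadyState_iff (y := y) hp hξ hinj hUΩ (hgS T U hUΩ)).2 ?_
    have : (fun K i => F (U K i) - y (T.node ξ K i)) = e := by
      funext K i
      rw [hU, (hFR _ (hrsub (hmem K i))).2, add_sub_cancel_left]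
    rw [this]
    exact he
  · obtain ⟨C, hC, h₀, hh₀, H⟩ := IsMeshError.exists_le hab hp hξ ht M
    -- The Lipschitz constant κ of the inverse flux converts flux errors into state errors; adding 1
    -- keeps the constant positive when κ = 0.
    refine ⟨(κ + 1) * C, by positivity, h₀, hh₀, fun h hh T hT U hU hUB => ?_⟩
    have herr : ∀ V : Fin T.N → Fin (p + 1) → (Fin m → ℝ),
        IsDiscreteSteadyState Ω F S φ α 𝒟 ξ (F (Ue a)) T V → (∀ K i, V K i ∈ B) →
        IsMeshError ξ g y T (fun K i => F (V K i) - y (T.node ξ K i)) ∧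
          ∀ K i, ‖g (F (V K i) - y (T.node ξ K i)) (T.node ξ K i)‖ ≤ M := by
      intro V hV hVB
      have hVS := hgS T V hV.admissible
      refine ⟨(isDiscreteSteadyState_iff (y := y) hp hξ hinj hV.admissible hVS).1 hV, fun K i => ?_⟩
      rw [hVS]
      exact hM _ (hVB K i) _ (T.node_mem hp hξ K i)
    obtain ⟨heU, hMU⟩ := herr U hU hUB
    obtain ⟨huniq, hends, hall⟩ := H h hh T hT _ heU hMU
    have hback : ∀ K i B', ‖F (U K i) - y (T.node ξ K i)‖ ≤ C * B' →
        ‖U K i - Ue (T.node ξ K i)‖ ≤ (κ + 1) * C * B' := by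
      intro K i B' hB'
      calc _ ≤ κ * ‖F (U K i) - F (Ue (T.node ξ K i))‖ :=
            hlip _ (hU.admissible K i) _ (hUe.admissible _ (T.node_mem hp hξ K i))
        _ ≤ (κ + 1) * (C * B') := by
            gcongr
            · linarith
        _ = _ := by ring
    refine ⟨fun V hV hVB => ?_, fun K => ?_, fun K i => hback K i _ (hall K i)⟩
    · obtain ⟨heV, hMV⟩ := herr V hV hVB
      have := huniq _ heV hMV
      funext K i
      refine hinj (hV.admissible K i) (hU.admissible K i) ?_
      exact sub_left_inj.1 (congrFun (congrFun this K) i)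
    · have h1 := hback K 0 _ (hends K).1
      have h2 := hback K (Fin.last p) _ (hends K).2
      rw [T.node_zero hp hξ] at h1
      rw [T.node_last hp hξ] at h2
      exact ⟨h1, h2⟩
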